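/- Let $n\ge 1$ and let $C^+\subset\mathbb{R}^n$ be a closed convex cone (closed under sums and under positive multiples) with $C^+\cap(-C^+)=\{0\}$ and $\operatorname{Int}C^+\neq\emptyset$. Write $x\le y$ if $y-x\in C^+$, $x<y$ if $y-x\in C^+\setminus\{0\}$ and $x\ll y$ if $y-x\in\operatorname{Int}C^+$. A set is unordered if no two distinct points of it are related by $\le$, and strongly ordered if any two distinct points of it are related by $\ll$. Let $\Phi=\{\Phi_t\}_{t\in\mathbb{R}}$ be a continuous flow on $\mathbb{R}^n$ with set of equilibria $E$, such that (H1) $\Phi$ is strongly competitive: $x\ll y$ whenever $\Phi_t(x)<\Phi_t(y)$ for some $t>0$; (H2) there is a nonempty compact set $\Gamma$ with $\Phi_t\Gamma=\Gamma$ for all $t\in\mathbb{R}$ which attracts some neighborhood of itself uniformly, and every compact set uniformly (that is, $d(\Phi_t(x),\Gamma)\to0$ as $t\to\infty$, uniformly for $x$ in that set). For $q\in E$ let $R_-(q)$ be the set of all $x$ such that $\Phi_{-t}(x)\to q$ as $t\to\infty$ and $\Phi_{-t}(x)\ll q$ for all sufficiently large $t$. Let $R_-(+\infty)$ be the interior of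 the set of all $x$ such that $|\Phi_{-t}(x)|\to\infty$ as $t\to\infty$ and, for all sufficiently large $t$, $a\ll\Phi_{-t}(x)$ for every lower bound $a$ of $\Gamma$ (if $\Gamma$ has an infimum $x_\star$ for $\le$, the last condition is $x_\star\ll\Phi_{-t}(x)$). For $q\in E\cup\{+\infty\}$ let $M_-(q)$ be the lower boundary of $R_-(q)$, that is, the set of all $z$ for which there is a sequence $u_i\to z$ in $R_-(q)$ with $z\ll u_i$ for all $i$, but no sequence $v_i\to z$ in $R_-(q)$ with $v_i\ll z$ for all $i$. Let $\mathcal{F}$ be the family of all nonempty sets $M_-(q)$, $q\in E\cup\{+\infty\}$. Then $\mathcal{F}$ is a countable family of pairwise disjoint, invariant, unordered open $(n-1)$-cells (subsets homeomorphic to $\mathbb{R}^{n-1}$). Moreover, for every Borel probability measure $\mu$ on $\mathbb{R}^n$ that is invariant under $\Phi$ (i.e. under $\Phi_t$ for all $t\ge0$) and every connected component $B$ of $\operatorname{supp}(\mu)$, either $B$ consists of equilibria and is strongly ordered, or $B$ is contained in one element of $\mathcal{F}$. -/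

import Mathlib

open Set Filter Topology MeasureTheory

namespace CompetitiveFlow

variable {E : Type*} [NormedAddCommGroup E] [NormedSpace ℝ E]

/-- A closed solid convex cone: closed, `C ∩ (-C) = {0}`, with nonempty interior
(closure under sums and positive multiples is part of `ConvexCone`). -/
structure IsSolidCone (C : ConvexCone ℝ E) : Prop where
  isClosed : IsClosed (C : Set E)
  pointed : ∀ x : E, (x ∈ C ∧ -x ∈ C) ↔ x = 0
  solid : (interior (C : Set E)).Nonempty

/-- `x ≤ y`. -/
def Le (C : ConvexCone ℝ E) (x y : E) : Prop := y - x ∈ C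

/-- `x < y`. -/
def Lt (C : ConvexCone ℝ E) (x y : E) : Prop := y - x ∈ (C : Set E) \ {0}

/-- `x ≪ y`. -/
def LL (C : ConvexCone ℝ E) (x y : E) : Prop := y - x ∈ interior (C : Set E)

/-- No two distinct points of `S` are related by `≤`. -/
def Unordered (C : ConvexCone ℝ E) (S : Set E) : Prop :=
  ∀ x ∈ S, ∀ y ∈ S, Le C x y → x = y

/-- Any two distinct points of `S` are related by `≪`. -/
def StronglyOrdered (C : ConvexCone ℝ E) (S : Set E) : Prop :=
  ∀ x ∈ S, ∀ y ∈ S, x ≠ y → LL C x y ∨ LL C y x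

/-- The set of equilibria. -/
def equilibria (Φ : Flow ℝ E) : Set E := {p | ∀ t : ℝ, Φ t p = p}

/-- `Φ_t D = D` for all `t`. -/
def Invariant (Φ : Flow ℝ E) (D : Set E) : Prop := ∀ t : ℝ, Φ t '' D = D

/-- The flow is strongly competitive: `x ≪ y` whenever `Φ_t x < Φ_t y` for some `t > 0`. -/
def StronglyCompetitive (C : ConvexCone ℝ E) (Φ : Flow ℝ E) : Prop :=
  ∀ x y : E, ∀ t : ℝ, 0 < t → Lt C (Φ t x) (Φ t y) → LL C x y

/-- `d(Φ_t x, Γ) → 0` as `t → ∞`, uniformly in `x ∈ N`. -/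
def UniformlyAttracts (Φ : Flow ℝ E) (Γ N : Set E) : Prop :=
  ∀ ε : ℝ, 0 < ε → ∃ T : ℝ, ∀ t : ℝ, T ≤ t → ∀ x ∈ N, Metric.infDist (Φ t x) Γ < ε

/-- A nonempty compact invariant set that uniformly attracts a neighborhood of itself. -/
structure IsAttractor (Φ : Flow ℝ E) (Γ : Set E) : Prop where
  nonempty : Γ.Nonempty
  isCompact : IsCompact Γ
  invariant : Invariant Φ Γ
  attracts : ∃ N ∈ 𝓝ˢ Γ, UniformlyAttracts Φ Γ N

/-- An attractor that uniformly attracts each compact set of initial values. -/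
structure IsDissipativeAttractor (Φ : Flow ℝ E) (Γ : Set E) : Prop where
  isAttractor : IsAttractor Φ Γ
  attracts_compact : ∀ A : Set E, IsCompact A → UniformlyAttracts Φ Γ A

/-- The basin of lower repulsion `R₋(q)` of an equilibrium `q`. -/
def lowerRepulsion (C : ConvexCone ℝ E) (Φ : Flow ℝ E) (q : E) : Set E :=
  {x | Tendsto (fun t : ℝ => Φ (-t) x) atTop (𝓝 q) ∧ ∀ᶠ t : ℝ in atTop, LL C (Φ (-t) x) q}

/-- `y` is strictly above every lower bound of `Γ`. If `Γ` has an infimum `x⋆`, this says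
`x⋆ ≪ y`, see `aboveLowerBounds_iff`. -/
def AboveLowerBounds (C : ConvexCone ℝ E) (Γ : Set E) (y : E) : Prop :=
  ∀ a : E, (∀ γ ∈ Γ, Le C a γ) → LL C a y

/-- The basin of lower repulsion `R₋(+∞)` of `+∞`: the interior of the set of the points whose
backward orbit tends to infinity in norm and is eventually strictly above every lower bound
of `Γ`. -/
def lowerRepulsionTop (C : ConvexCone ℝ E) (Φ : Flow ℝ E) (Γ : Set E) : Set E :=
  interior {x | Tendsto (fun t : ℝ => ‖Φ (-t) x‖) atTop atTop ∧
    ∀ᶠ t : ℝ in atTop, AboveLowerBounds C Γ (Φ (-t) x)}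

/-- The lower boundary `∂₋ S`: the points `z` such that some sequence in `S` converges to `z` from
strictly above, and no sequence in `S` converges to `z` from strictly below. -/
def lowerBoundary (C : ConvexCone ℝ E) (S : Set E) : Set E :=
  {z | (∃ u : ℕ → E, (∀ i, u i ∈ S ∧ LL C z (u i)) ∧ Tendsto u atTop (𝓝 z)) ∧
    ¬ ∃ v : ℕ → E, (∀ i, v i ∈ S ∧ LL C (v i) z) ∧ Tendsto v atTop (𝓝 z)}

/-- The family `F` of all nonempty sets among `M₋(q) = ∂₋ R₋(q)`, `q` an equilibrium or `+∞`. -/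
def cellFamily (C : ConvexCone ℝ E) (Φ : Flow ℝ E) (Γ : Set E) : Set (Set E) :=
  {M | M.Nonempty ∧ (M = lowerBoundary C (lowerRepulsionTop C Φ Γ) ∨
    ∃ q ∈ equilibria Φ, M = lowerBoundary C (lowerRepulsion C Φ q))}

/-- An open `k`-cell: a subset homeomorphic to `ℝ^k`. -/
def IsOpenCell (k : ℕ) (M : Set E) : Prop := Nonempty (M ≃ₜ EuclideanSpace ℝ (Fin k))

/-- `C + Int C ⊆ Int C`, in terms of the order relations. -/
theorem Le.trans_LL {C : ConvexCone ℝ E} {x y z : E} (h : Le C x y) (h' : LL C y z) :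
    LL C x z := by
  unfold LL Le at *
  have hsub : (fun w => (y - x) + w) '' interior (C : Set E) ⊆ interior (C : Set E) := by
    apply interior_maximal
    · rintro _ ⟨w, hw, rfl⟩
      exact C.add_mem h (interior_subset hw)
    · exact (Homeomorph.addLeft (y - x)).isOpenMap _ isOpen_interior
  have := hsub ⟨z - y, h', rfl⟩
  simpa using this

theorem aboveLowerBounds_iff {C : ConvexCone ℝ E} {Γ : Set E} {xs : E}
    (hlb : ∀ γ ∈ Γ, Le C xs γ) (hglb : ∀ a : E, (∀ γ ∈ Γ, Le C a γ) → Le C a xs) (y : E) :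
    AboveLowerBounds C Γ y ↔ LL C xs y :=
  ⟨fun h => h xs hlb, fun h a ha => (hglb a ha).trans_LL h⟩

end CompetitiveFlow

set_option linter.unusedSectionVars false

namespace CompetitiveFlow

/-! ### Order calculus of the cone -/

section Order

variable {E : Type*} [NormedAddCommGroup E] [NormedSpace ℝ E] {C : ConvexCone ℝ E} {x y z v : E}

/-! Reversing time turns the competitive flow into a strongly monotone flow `Ψ` for which `Γ` is a
compact invariant set and every orbit starting outside `Γ` escapes to infinity (`MonotoneRepeller`).
The sets `R₋(q)` and `R₋(+∞)` become basins of attraction from below of the "ends" `q` and `+∞`.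
They are invariant, open, pairwise disjoint and order convex. Openness and separability give
countability.

Cells. Fix `v` in the interior of the cone. By order convexity the lower boundary of a basin `R` is
its lower edge in direction `v`: the points outside `R` from which the ray along `v` enters `R` at
once. Each line parallel to `v` meets the edge at most once, so the edge is a continuous graph over
the projection of `R` along `v` (`nonempty_homeomorph_lowerEdge`). For `+∞` this projection is the
whole hyperplane. For an equilibrium, `R` is an increasing union of preimages under `Ψ` of one order
interval; the projection of the interval is bounded, open and convex, and the flow identifies the
edges of the preimages with the edge of the interval. So the projection of `R` is an increasing
union of open cells, hence an open cell by Brown's theorem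
(`nonempty_homeomorph_of_monotone_union`). Strong monotonicity and invariance make edges unordered.

Dichotomy. By Poincaré recurrence the support `L` of an invariant measure is closed and invariant
with dense recurrent points (`RecurrentSet`). For `x ∈ L` and `y ≫ x` in `Γ`, some omega limit point
of `y` has its whole orbit above the whole orbit of `x` (`exists_mem_orbitUpper`). Applied to `y = x
+ ε • v` as `ε → 0`, this shows that `x` lies in a cell, or is an equilibrium accumulated by omega
limit points of such `y` (`mem_cell_or_softAbove`).

A connected `B ⊆ L` not inside one cell is then handled by comparison with equilibria. Being
unrelated to an equilibrium `e` is an open condition; being related to it is open in `L` away from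
`e`, because in `L` the relation `≤` with `e` upgrades to `≪`. Connectedness thus shows that soft
points, and points where `B` leaves a cell, are equilibria related to all of `B`
(`not_unrelated_of_softAbove`, `not_unrelated_of_boundary`). As a cell is unordered, it meets `B` at
most in one such point, so `B` consists of strongly ordered equilibria. -/

theorem LL.le (h : LL C x y) : Le C x y := interior_subset h

theorem Le.trans (h : Le C x y) (h' : Le C y z) : Le C x z := by
  have := C.add_mem h h'
  simpa [Le] using this

theorem LL.trans_le (h : LL C x y) (h' : Le C y z) : LL C x z := by
  have h1 : Le C (-z) (-y) := by unfold Le at *; convert h' using 1; abel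
  have h2 : LL C (-y) (-x) := by unfold LL at *; convert h using 1; abel
  have := h1.trans_LL h2
  unfold LL at *
  convert this using 1
  abel

theorem LL.trans (h : LL C x y) (h' : LL C y z) : LL C x z := h.trans_le h'.le

theorem IsSolidCone.le_refl (hC : IsSolidCone C) (x : E) : Le C x x := by
  have := ((hC.pointed 0).2 rfl).1
  simpa [Le] using this

theorem IsSolidCone.le_antisymm (hC : IsSolidCone C) (h : Le C x y) (h' : Le C y x) : x = y := by
  have := (hC.pointed (y - x)).1 ⟨h, by rw [neg_sub]; exact h'⟩
  exact (sub_eq_zero.1 this).symm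

theorem IsSolidCone.isClosed_le (hC : IsSolidCone C) : IsClosed {p : E × E | Le C p.1 p.2} :=
  hC.isClosed.preimage (continuous_snd.sub continuous_fst)

theorem isOpen_ll : IsOpen {p : E × E | LL C p.1 p.2} :=
  isOpen_interior.preimage (continuous_snd.sub continuous_fst)

theorem isOpen_ll_left (y : E) : IsOpen {x : E | LL C x y} :=
  isOpen_interior.preimage (continuous_const.sub continuous_id)

theorem isOpen_ll_right (x : E) : IsOpen {y : E | LL C x y} :=
  isOpen_interior.preimage (continuous_id.sub continuous_const)

theorem IsSolidCone.isClosed_le_left (hC : IsSolidCone C) (y : E) : IsClosed {x : E | Le C x y} :=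
  hC.isClosed.preimage (continuous_const.sub continuous_id)

theorem IsSolidCone.isClosed_le_right (hC : IsSolidCone C) (x : E) : IsClosed {y : E | Le C x y} :=
  hC.isClosed.preimage (continuous_id.sub continuous_const)

theorem IsSolidCone.le_of_tendsto (hC : IsSolidCone C) {ι : Type*} {l : Filter ι} {f g : ι → E}
    (hf : Tendsto f l (𝓝 x)) (hg : Tendsto g l (𝓝 y)) (h : ∃ᶠ i in l, Le C (f i) (g i)) :
    Le C x y :=
  hC.isClosed_le.mem_of_frequently_of_tendsto h (hf.prodMk_nhds hg)

theorem LL.eventually {ι : Type*} {l : Filter ι} {f g : ι → E} (h : LL C x y)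
    (hf : Tendsto f l (𝓝 x)) (hg : Tendsto g l (𝓝 y)) : ∀ᶠ i in l, LL C (f i) (g i) :=
  (hf.prodMk_nhds hg).eventually (isOpen_ll.mem_nhds h)

theorem lt_iff : Lt C x y ↔ Le C x y ∧ x ≠ y := by
  simp [Lt, Le, sub_eq_zero, eq_comm]

theorem smul_mem_interior (hv : v ∈ interior (C : Set E)) {ε : ℝ} (hε : 0 < ε) :
    ε • v ∈ interior (C : Set E) := by
  have : (fun w => ε • w) '' interior (C : Set E) ⊆ interior (C : Set E) := by
    apply interior_maximal
    · rintro _ ⟨w, hw, rfl⟩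
      exact C.smul_mem hε (interior_subset hw)
    · exact isOpenMap_smul₀ hε.ne' _ isOpen_interior
  exact this ⟨v, hv, rfl⟩

theorem ll_add_smul (hv : v ∈ interior (C : Set E)) {ε : ℝ} (hε : 0 < ε) (x : E) :
    LL C x (x + ε • v) := by
  simpa [LL] using smul_mem_interior hv hε

theorem sub_smul_ll (hv : v ∈ interior (C : Set E)) {ε : ℝ} (hε : 0 < ε) (x : E) :
    LL C (x - ε • v) x := by
  simpa [LL] using smul_mem_interior hv hε

theorem add_smul_ll_add_smul (hv : v ∈ interior (C : Set E)) {a b : ℝ} (h : a < b) (x : E) :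
    LL C (x + a • v) (x + b • v) := by
  have := smul_mem_interior hv (sub_pos.2 h)
  unfold LL
  convert this using 1
  module

theorem tendsto_add_smul (x v : E) : Tendsto (fun ε : ℝ => x + ε • v) (𝓝[>] 0) (𝓝 x) := by
  have : Continuous fun ε : ℝ => x + ε • v := by fun_prop
  simpa using (this.tendsto 0).mono_left nhdsWithin_le_nhds

theorem LL.eventually_add_smul (h : LL C x y) (v : E) :
    ∀ᶠ ε : ℝ in 𝓝[>] 0, LL C (x + ε • v) y :=
  h.eventually (tendsto_add_smul x v) tendsto_const_nhds

theorem eventually_ll_add_smul (hv : v ∈ interior (C : Set E)) {ε : ℝ} (hε : 0 < ε) (x : E) :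
    ∀ᶠ y in 𝓝 x, LL C y (x + ε • v) :=
  (isOpen_ll_left _).mem_nhds (ll_add_smul hv hε x)

theorem IsSolidCone.not_ll_self [Nontrivial E] (hC : IsSolidCone C) (x : E) : ¬ LL C x x := by
  intro h
  unfold LL at h
  rw [sub_self] at h
  obtain ⟨w, hw⟩ := exists_ne (0 : E)
  have h1 := tendsto_add_smul (0 : E) w
  have h2 := tendsto_add_smul (0 : E) (-w)
  have hn := mem_interior_iff_mem_nhds.1 h
  obtain ⟨ε, ⟨h3, h4⟩, hε⟩ :=
    (((h1.eventually hn).and (h2.eventually hn)).and eventually_mem_nhdsWithin).exists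
  have hε : (0 : ℝ) < ε := hε
  have : ε • w = 0 := by
    rw [zero_add] at h3
    rw [zero_add, smul_neg] at h4
    exact (hC.pointed _).1 ⟨h3, h4⟩
  rcases smul_eq_zero.1 this with h | h
  · exact hε.ne' h
  · exact hw h

theorem LL.ne [Nontrivial E] (hC : IsSolidCone C) (h : LL C x y) : x ≠ y := by
  rintro rfl
  exact hC.not_ll_self x h

theorem LL.lt [Nontrivial E] (hC : IsSolidCone C) (h : LL C x y) : Lt C x y :=
  lt_iff.2 ⟨h.le, h.ne hC⟩

theorem LL.not_le [Nontrivial E] (hC : IsSolidCone C) (h : LL C x y) : ¬ Le C y x :=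
  fun h' => hC.not_ll_self x (h.trans_le h')

/-- Closed cones containing no line are normal in finite dimension. -/
theorem IsSolidCone.exists_normal [FiniteDimensional ℝ E] (hC : IsSolidCone C) :
    ∃ κ : ℝ, 0 < κ ∧ ∀ x y z : E, Le C x y → Le C y z → ‖y - x‖ ≤ κ * ‖z - x‖ := by
  by_contra! hcon
  -- A violation of normality with constant `n + 1`, rescaled by `‖y - x‖`, gives a unit vector `a`
  -- of the cone dominated by a `b` of norm at most `1 / (n + 1)`. A limit of such `a` is a unit
  -- vector `w` with `w` and `-w` in the cone.
  have hex : ∀ n : ℕ, ∃ a b : E, a ∈ C ∧ b - a ∈ C ∧ ‖a‖ = 1 ∧ ‖b‖ ≤ 1 / (n + 1 : ℝ) := by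
    intro n
    obtain ⟨x, y, z, hxy, hyz, hlt⟩ := hcon (n + 1) (by positivity)
    have hpos : 0 < ‖y - x‖ := lt_of_le_of_lt (by positivity) hlt
    refine ⟨‖y - x‖⁻¹ • (y - x), ‖y - x‖⁻¹ • (z - x), C.smul_mem (inv_pos.2 hpos) hxy, ?_, ?_, ?_⟩
    · rw [← smul_sub]
      refine C.smul_mem (inv_pos.2 hpos) ?_
      rw [sub_sub_sub_cancel_right]
      exact hyz
    · rw [norm_smul, norm_inv, norm_norm, inv_mul_cancel₀ hpos.ne']
    · rw [norm_smul, norm_inv, norm_norm, inv_mul_eq_div, div_le_div_iff₀ hpos (by positivity)]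
      linarith
  choose a b ha hab hna hnb using hex
  obtain ⟨w, hw, φ, hφ, hlim⟩ := (isCompact_sphere (0 : E) 1).tendsto_subseq
    (x := a) (fun n => by simp [hna])
  have hb : Tendsto b atTop (𝓝 0) :=
    squeeze_zero_norm hnb tendsto_one_div_add_atTop_nhds_zero_nat
  have h1 : w ∈ C := hC.isClosed.mem_of_tendsto hlim (Eventually.of_forall fun n => ha _)
  have h2 : 0 - w ∈ (C : Set E) := hC.isClosed.mem_of_tendsto
    ((hb.comp hφ.tendsto_atTop).sub hlim) (Eventually.of_forall fun n => hab _)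
  have : w = 0 := (hC.pointed w).1 ⟨h1, by simpa using h2⟩
  simp [this] at hw

/-- Every bounded set is dominated from below. -/
theorem exists_forall_le (hv : v ∈ interior (C : Set E)) {S : Set E}
    (hS : Bornology.IsBounded S) : ∃ a : E, ∀ x ∈ S, Le C a x := by
  obtain ⟨r, hr, hball⟩ := Metric.mem_nhds_iff.1 (mem_interior_iff_mem_nhds.1 hv)
  obtain ⟨K, hK0, hK⟩ := hS.exists_pos_norm_lt
  refine ⟨-((K / r) • v), fun x hx => ?_⟩
  have h1 : v + (r / K) • x ∈ C := by
    apply hball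
    rw [Metric.mem_ball, dist_eq_norm, add_sub_cancel_left, norm_smul, Real.norm_eq_abs,
      abs_of_pos (by positivity), div_mul_eq_mul_div, div_lt_iff₀ hK0]
    exact mul_lt_mul_of_pos_left (hK x hx) hr
  have h2 := C.smul_mem (show 0 < K / r by positivity) h1
  unfold Le
  convert h2 using 1
  rw [smul_add, smul_smul, div_mul_div_comm, mul_comm K r, div_self (by positivity)]
  module

end Order

/-! ### Brown's theorem on monotone unions of open cells -/

section MonotoneUnion

variable {H : Type*} [NormedAddCommGroup H] [NormedSpace ℝ H]

/-- The radial map of `H` induced by a self-map of the half-line. -/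
noncomputable def radialMap (e : ℝ → ℝ) (x : H) : H := (e ‖x‖ / ‖x‖) • x

theorem radialMap_of_eq {e : ℝ → ℝ} {x : H} (h : e ‖x‖ = ‖x‖) : radialMap e x = x := by
  unfold radialMap
  rcases eq_or_ne x 0 with rfl | hx
  · simp
  · rw [h, div_self (norm_ne_zero_iff.2 hx), one_smul]

theorem norm_radialMap {e : ℝ → ℝ} (h0 : e 0 = 0) (he : ∀ t, 0 ≤ t → 0 ≤ e t) (x : H) :
    ‖radialMap e x‖ = e ‖x‖ := by
  unfold radialMap
  rcases eq_or_ne x 0 with rfl | hx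
  · simp [h0]
  · have := norm_ne_zero_iff.2 hx
    rw [norm_smul, norm_div, norm_norm, Real.norm_of_nonneg (he _ (norm_nonneg _)),
      div_mul_cancel₀ _ this]

theorem radialMap_radialMap {e f : ℝ → ℝ} (h0 : e 0 = 0) (he : ∀ t, 0 ≤ t → 0 ≤ e t)
    (hpos : ∀ t, 0 < t → e t ≠ 0) (hfe : ∀ t, f (e t) = t) (x : H) :
    radialMap f (radialMap e x) = x := by
  rcases eq_or_ne x 0 with rfl | hx
  · simp [radialMap]
  · have hx' := norm_ne_zero_iff.2 hx
    have := hpos _ (norm_pos_iff.2 hx)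
    rw [radialMap, norm_radialMap h0 he, hfe, radialMap, smul_smul, div_mul_div_comm,
      mul_comm, div_self (mul_ne_zero this hx'), one_smul]

theorem continuous_radialMap {e : ℝ → ℝ} (hc : Continuous e) {a : ℝ} (ha : 0 < a)
    (hea : ∀ t ≤ a, e t = t) : Continuous (radialMap e : H → H) := by
  rw [continuous_iff_continuousAt]
  intro x
  rcases eq_or_ne x 0 with rfl | hx
  · have : (radialMap e : H → H) =ᶠ[𝓝 0] id := by
      filter_upwards [Metric.ball_mem_nhds (0 : H) ha] with y hy
      exact radialMap_of_eq (hea _ (mem_ball_zero_iff.1 hy).le)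
    exact continuousAt_id.congr this.symm
  · exact ((hc.continuousAt.comp continuous_norm.continuousAt).div continuous_norm.continuousAt
      (norm_ne_zero_iff.2 hx)).smul continuousAt_id

theorem exists_orderIso_stretch {a s c d : ℝ} (has : a < s) (hsc : s ≤ c) (hcd : c < d) :
    ∃ e : ℝ ≃o ℝ, (∀ t ≤ a, e t = t) ∧ (∀ t, d ≤ t → e t = t) ∧ e s = c := by
  have h1 : 0 < (c - a) / (s - a) := div_pos (by linarith) (by linarith)
  have h1' : 1 ≤ (c - a) / (s - a) := (one_le_div (by linarith)).2 (by linarith)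
  have h2 : 0 < (d - c) / (d - s) := div_pos (by linarith) (by linarith)
  have h2' : (d - c) / (d - s) ≤ 1 := (div_le_one (by linarith)).2 (by linarith)
  set m₁ := (c - a) / (s - a) with hm1
  set m₂ := (d - c) / (d - s) with hm2
  have e1 : a + m₁ * (s - a) = c := by
    rw [hm1, div_mul_cancel₀ _ (by linarith)]; ring
  have e2 : d + m₂ * (s - d) = c := by
    have : m₂ * (d - s) = d - c := by rw [hm2, div_mul_cancel₀ _ (by linarith)]
    linarith
  -- The two lines join `(a, a)` to `(s, c)` and `(s, c)` to `(d, d)`. Their minimum is the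
  -- stretched part; the maximum with the identity restores `t` outside `[a, d]`.
  set f : ℝ → ℝ := fun t => max t (min (a + m₁ * (t - a)) (d + m₂ * (t - d))) with hf
  have hmono : StrictMono f := by
    intro x y hxy
    have hx1 : m₁ * x < m₁ * y := mul_lt_mul_of_pos_left hxy h1
    have hx2 : m₂ * x < m₂ * y := mul_lt_mul_of_pos_left hxy h2
    refine max_lt_max hxy (min_lt_min ?_ ?_) <;> nlinarith
  have hlow : ∀ t ≤ a, f t = t := by
    intro t ht
    refine max_eq_left (min_le_of_left_le ?_)
    nlinarith
  have hhigh : ∀ t, d ≤ t → f t = t := by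
    intro t ht
    refine max_eq_left (min_le_of_right_le ?_)
    nlinarith
  have hcont : Continuous f := by fun_prop
  have htop : Tendsto f atTop atTop :=
    tendsto_id.congr' ((eventually_ge_atTop d).mono fun t ht => (hhigh t ht).symm)
  have hbot : Tendsto f atBot atBot :=
    tendsto_id.congr' ((eventually_le_atBot a).mono fun t ht => (hlow t ht).symm)
  refine ⟨hmono.orderIsoOfSurjective f (hcont.surjective htop hbot), hlow, hhigh, ?_⟩
  change max s (min (a + m₁ * (s - a)) (d + m₂ * (s - d))) = c
  rw [e1, e2, min_self, max_eq_right hsc]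

theorem exists_homeomorph_stretch {a s c d : ℝ} (ha : 0 < a) (has : a < s) (hsc : s ≤ c)
    (hcd : c < d) :
    ∃ σ : H ≃ₜ H, (∀ x, ‖x‖ ≤ a → σ x = x) ∧ (∀ x, d ≤ ‖x‖ → σ x = x) ∧
      ∀ x, ‖x‖ ≤ c → ‖σ.symm x‖ ≤ s := by
  obtain ⟨e, hlow, hhigh, hes⟩ := exists_orderIso_stretch has hsc hcd
  have hlow' : ∀ t ≤ a, e.symm t = t := fun t ht => by
    rw [OrderIso.symm_apply_eq, hlow t ht]
  have h0 : e 0 = 0 := hlow 0 ha.le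
  have h0' : e.symm 0 = 0 := hlow' 0 ha.le
  have hnn : ∀ t, 0 ≤ t → 0 ≤ e t := fun t ht => h0 ▸ e.monotone ht
  have hnn' : ∀ t, 0 ≤ t → 0 ≤ e.symm t := fun t ht => h0' ▸ e.symm.monotone ht
  have hp : ∀ t, 0 < t → e t ≠ 0 := fun t ht h => ht.ne' (e.injective (h.trans h0.symm))
  have hp' : ∀ t, 0 < t → e.symm t ≠ 0 :=
    fun t ht h => ht.ne' (e.symm.injective (h.trans h0'.symm))
  refine ⟨{ toFun := radialMap e, invFun := radialMap e.symm,
            left_inv := radialMap_radialMap h0 hnn hp e.symm_apply_apply,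
            right_inv := radialMap_radialMap h0' hnn' hp' e.apply_symm_apply,
            continuous_toFun := continuous_radialMap e.continuous ha hlow,
            continuous_invFun := continuous_radialMap e.symm.continuous ha hlow' }, ?_, ?_, ?_⟩
  · exact fun x hx => radialMap_of_eq (hlow _ hx)
  · exact fun x hx => radialMap_of_eq (hhigh _ hx)
  · intro x hx
    change ‖radialMap e.symm x‖ ≤ s
    rw [norm_radialMap h0' hnn', ← e.symm_apply_apply s, hes]
    exact e.symm.monotone hx

theorem norm_le_of_fix_outside {σ : H ≃ₜ H} {d : ℝ} (hσ : ∀ x, d ≤ ‖x‖ → σ x = x) {x : H}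
    (hx : ‖x‖ ≤ d) : ‖σ x‖ ≤ d := by
  by_contra! h
  have := σ.injective (hσ _ h.le)
  rw [this] at h
  exact absurd hx h.not_ge

theorem fix_outside_symm {σ : H ≃ₜ H} {d : ℝ} (hσ : ∀ x, d ≤ ‖x‖ → σ x = x) (x : H)
    (hx : d ≤ ‖x‖) : σ.symm x = x := by
  rw [σ.symm_apply_eq, hσ x hx]

variable {X : Type*} [TopologicalSpace X]

open Classical in
/-- A self-map of the chart domain, extended by the identity. -/
noncomputable def extendMap (G : H → X) (σ : H → H) (y : X) : X :=
  if h : ∃ x, G x = y then G (σ h.choose) else y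

theorem extendMap_apply {G : H → X} (hG : Function.Injective G) (σ : H → H) (x : H) :
    extendMap G σ (G x) = G (σ x) := by
  have h : ∃ z, G z = G x := ⟨x, rfl⟩
  rw [extendMap, dif_pos h, hG h.choose_spec]

theorem extendMap_of_notMem {G : H → X} (hG : Function.Injective G) {σ : H → H} {d : ℝ}
    (hσ : ∀ x, d ≤ ‖x‖ → σ x = x) {y : X} (hy : y ∉ G '' Metric.closedBall 0 d) :
    extendMap G σ y = y := by
  by_cases h : ∃ x, G x = y
  · obtain ⟨x, rfl⟩ := h
    rw [extendMap_apply hG, hσ]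
    by_contra! hx
    exact hy ⟨x, by simpa using hx.le, rfl⟩
  · rw [extendMap, dif_neg h]

theorem extendMap_extendMap {G : H → X} (hG : Function.Injective G) {σ τ : H → H}
    (h : ∀ x, τ (σ x) = x) (y : X) : extendMap G τ (extendMap G σ y) = y := by
  by_cases hy : ∃ x, G x = y
  · obtain ⟨x, rfl⟩ := hy
    rw [extendMap_apply hG, extendMap_apply hG, h]
  · have : extendMap G σ y = y := by rw [extendMap, dif_neg hy]
    rw [this, extendMap, dif_neg hy]

variable [T2Space X] [ProperSpace H]

/-- The image of the closed ball is compact, hence closed in a Hausdorff space, so the extension is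
the identity on an open set which together with the chart covers `X`. -/
theorem continuous_extendMap {G : H → X} (hG : IsOpenEmbedding G) {σ : H → H}
    (hc : Continuous σ) {d : ℝ} (hσ : ∀ x, d ≤ ‖x‖ → σ x = x) : Continuous (extendMap G σ) := by
  rw [continuous_iff_continuousAt]
  intro y
  by_cases hy : y ∈ G '' Metric.closedBall 0 d
  · obtain ⟨x, -, rfl⟩ := hy
    rw [← hG.continuousAt_iff]
    have : extendMap G σ ∘ G = G ∘ σ := funext fun x => extendMap_apply hG.injective σ x
    rw [this]
    exact (hG.continuous.comp hc).continuousAt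
  · have hcl : IsClosed (G '' Metric.closedBall 0 d) :=
      ((isCompact_closedBall _ _).image hG.continuous).isClosed
    refine continuousAt_id.congr ?_
    filter_upwards [hcl.isOpen_compl.mem_nhds hy] with z hz
    exact (extendMap_of_notMem hG.injective hσ hz).symm

/-- A homeomorphism of `H` with bounded support, transported by an open embedding. -/
theorem exists_homeomorph_extend {G : H → X} (hG : IsOpenEmbedding G) (σ : H ≃ₜ H) {d : ℝ}
    (hσ : ∀ x, d ≤ ‖x‖ → σ x = x) :
    ∃ φ : X ≃ₜ X, (∀ x, φ (G x) = G (σ x)) ∧ ∀ y ∉ G '' Metric.closedBall 0 d, φ y = y :=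
  ⟨{ toFun := extendMap G σ, invFun := extendMap G σ.symm,
     left_inv := extendMap_extendMap hG.injective σ.symm_apply_apply,
     right_inv := extendMap_extendMap hG.injective σ.apply_symm_apply,
     continuous_toFun := continuous_extendMap hG σ.continuous hσ,
     continuous_invFun := continuous_extendMap hG σ.symm.continuous (fix_outside_symm hσ) },
   fun x => extendMap_apply hG.injective _ x, fun _ hy => extendMap_of_notMem hG.injective hσ hy⟩

/-- Given two cells with a common centre, the smaller can be pushed over a compact part of the
larger, keeping a given ball fixed. -/
theorem exists_homeomorph_engulf {G G' : H → X} (hG : IsOpenEmbedding G)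
    (hG' : IsOpenEmbedding G') (h0 : G' 0 = G 0) {a b : ℝ} (ha : 0 < a) (hab : a < b)
    {K : Set X} (hK : IsCompact K) (hKG : K ⊆ range G')
    (hbG : G '' Metric.closedBall 0 b ⊆ range G') :
    ∃ φ : X ≃ₜ X, (∀ x, ‖x‖ ≤ a → φ (G x) = G x) ∧
      K ⊆ (fun x => φ (G x)) '' Metric.closedBall 0 b := by
  have hb : 0 < b := ha.trans hab
  obtain ⟨c, hc⟩ : ∃ c : ℝ, K ∪ G '' Metric.closedBall 0 b ⊆ G' '' Metric.closedBall 0 c := by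
    have hcomp : IsCompact (G' ⁻¹' (K ∪ G '' Metric.closedBall 0 b)) :=
      hG'.isInducing.isCompact_preimage_iff (union_subset hKG hbG) |>.2
        (hK.union ((isCompact_closedBall _ _).image hG.continuous))
    obtain ⟨c, hc⟩ := hcomp.isBounded.subset_closedBall 0
    refine ⟨c, fun y hy => ?_⟩
    obtain ⟨x, rfl⟩ := (union_subset hKG hbG) hy
    exact ⟨x, hc hy, rfl⟩
  obtain ⟨s, hs, hsG⟩ : ∃ s > 0, G' '' Metric.closedBall 0 s ⊆ G '' Metric.closedBall 0 b := by
    have : G' ⁻¹' (G '' Metric.ball 0 b) ∈ 𝓝 (0 : H) :=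
      (hG.isOpenMap _ Metric.isOpen_ball).preimage hG'.continuous |>.mem_nhds
        ⟨0, by simpa using hb, h0.symm⟩
    obtain ⟨s, hs, hsub⟩ := Metric.nhds_basis_closedBall.mem_iff.1 this
    exact ⟨s, hs, (image_subset_iff.2 hsub).trans (image_mono Metric.ball_subset_closedBall)⟩
  obtain ⟨η', hη', hηG'⟩ : ∃ η > 0, G '' Metric.closedBall 0 η ⊆
      G' '' Metric.closedBall 0 (s / 2) := by
    have : G ⁻¹' (G' '' Metric.ball 0 (s / 2)) ∈ 𝓝 (0 : H) :=
      (hG'.isOpenMap _ Metric.isOpen_ball).preimage hG.continuous |>.mem_nhds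
        ⟨0, by simpa using hs, h0⟩
    obtain ⟨s, hs, hsub⟩ := Metric.nhds_basis_closedBall.mem_iff.1 this
    exact ⟨s, hs, (image_subset_iff.2 hsub).trans (image_mono Metric.ball_subset_closedBall)⟩
  set η := min η' a with hη
  have hηpos : 0 < η := lt_min hη' ha
  have hηG : G '' Metric.closedBall 0 η ⊆ G' '' Metric.closedBall 0 (s / 2) :=
    (image_mono (Metric.closedBall_subset_closedBall (min_le_left _ _))).trans hηG'
  -- The inverse of `σ₁` shrinks the ball of radius `a` into that of radius `η`, with support in
  -- radius `b`. The map `σ₂` blows the ball of radius `s` up over that of radius `c`, and fixes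
  -- radius `s / 2`.
  obtain ⟨σ₁, h1low, h1high, h1⟩ := exists_homeomorph_stretch (H := H) (half_pos hηpos)
    (half_lt_self hηpos) (min_le_right η' a) hab
  obtain ⟨σ₂, h2low, h2high, h2⟩ := exists_homeomorph_stretch (H := H) (half_pos hs)
    (half_lt_self hs) (le_max_left s c) (lt_add_one (max s c))
  obtain ⟨χ, hχ, hχ'⟩ := exists_homeomorph_extend hG σ₁ h1high
  obtain ⟨τ, hτ, -⟩ := exists_homeomorph_extend hG' σ₂ h2high
  have hχs : ∀ x, χ.symm (G x) = G (σ₁.symm x) := fun x => by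
    rw [χ.symm_apply_eq, hχ, σ₁.apply_symm_apply]
  have hτs : ∀ x, τ.symm (G' x) = G' (σ₂.symm x) := fun x => by
    rw [τ.symm_apply_eq, hτ, σ₂.apply_symm_apply]
  -- The expansion `τ` fixes the small ball of radius `η` in the chart `G`; conjugating by `χ`
  -- enlarges this fixed ball to radius `a`.
  refine ⟨(χ.symm.trans τ).trans χ, fun x hx => ?_, fun y hy => ?_⟩
  · obtain ⟨w, hw, hwe⟩ := hηG ⟨σ₁.symm x, by simpa using h1 x hx, rfl⟩
    simp only [Homeomorph.trans_apply]
    rw [hχs, ← hwe, hτ, h2low w (by simpa using hw), hwe, hχ, σ₁.apply_symm_apply]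
  · have hy1 : χ.symm y ∈ G' '' Metric.closedBall 0 c := by
      by_cases hyb : y ∈ G '' Metric.closedBall 0 b
      · obtain ⟨x, hx, rfl⟩ := hyb
        rw [hχs]
        refine hc (Or.inr ⟨_, ?_, rfl⟩)
        simpa using norm_le_of_fix_outside (fix_outside_symm h1high) (by simpa using hx)
      · have : χ.symm y = y := by rw [χ.symm_apply_eq, hχ' y hyb]
        rw [this]
        exact hc (Or.inl hy)
    obtain ⟨w, hw, hwe⟩ := hy1
    have hy2 : τ.symm (χ.symm y) ∈ G '' Metric.closedBall 0 b := by
      rw [← hwe, hτs]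
      refine hsG ⟨_, ?_, rfl⟩
      simpa using h2 w ((mem_closedBall_zero_iff.1 hw).trans (le_max_right s c))
    obtain ⟨x, hx, hxe⟩ := hy2
    refine ⟨σ₁ x, ?_, ?_⟩
    · simpa using norm_le_of_fix_outside h1high (by simpa using hx)
    · simp only [Homeomorph.trans_apply]
      rw [← hχ, χ.symm_apply_apply, hxe, τ.apply_symm_apply, χ.apply_symm_apply]

theorem exists_isOpenEmbedding_centered {U : Set X} (hU : IsOpen U) (h : Nonempty (H ≃ₜ U))
    {x₀ : X} (hx : x₀ ∈ U) : ∃ G : H → X, IsOpenEmbedding G ∧ G 0 = x₀ ∧ range G = U := by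
  obtain ⟨h⟩ := h
  let τ : H ≃ₜ H := Homeomorph.addRight (h.symm ⟨x₀, hx⟩)
  refine ⟨fun x => (h (τ x) : X), ?_, ?_, ?_⟩
  · exact hU.isOpenEmbedding_subtypeVal.comp (h.isOpenEmbedding.comp τ.isOpenEmbedding)
  · simp [τ]
  · have : (fun x => (h (τ x) : X)) = Subtype.val ∘ (τ.trans h) := rfl
    rw [this, (τ.trans h).surjective.range_comp, Subtype.range_val]

/-- A space that is the union of an increasing sequence of open cells is an open cell. -/
theorem nonempty_homeomorph_of_monotone_union [SigmaCompactSpace X] {U : ℕ → Set X}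
    (hU : ∀ k, IsOpen (U k)) (hmono : Monotone U) (hcov : ⋃ k, U k = univ)
    (hcell : ∀ k, Nonempty (H ≃ₜ U k)) : Nonempty (H ≃ₜ X) := by
  have hsub : ∀ K : Set X, IsCompact K → ∃ k, K ⊆ U k := fun K hK =>
    hK.elim_directed_cover U hU (hcov ▸ subset_univ K) hmono.directed_le
  obtain ⟨x₀, hx₀⟩ : ∃ x, x ∈ U 0 := by
    obtain ⟨h⟩ := hcell 0
    exact ⟨h 0, (h 0).2⟩
  obtain ⟨G₀, hG₀, hG₀0, -⟩ := exists_isOpenEmbedding_centered (hU 0) (hcell 0) hx₀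
  let T := {G : H → X // IsOpenEmbedding G ∧ G 0 = x₀}
  -- Each chart is corrected outside radius `k + 1` so that its ball of radius `k + 2` swallows the
  -- next compact set. The fixed balls exhaust `H`, so the charts stabilise locally.
  have step : ∀ (k : ℕ) (G : T), ∃ G' : T, (∀ x, ‖x‖ ≤ k + 1 → G'.1 x = G.1 x) ∧
      compactCovering X k ⊆ G'.1 '' Metric.closedBall 0 (k + 2) := by
    rintro k ⟨G, hG, hG0⟩
    have hc1 := isCompact_compactCovering X k
    have hc2 : IsCompact (G '' Metric.closedBall 0 ((k : ℝ) + 2)) :=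
      (isCompact_closedBall _ _).image hG.continuous
    obtain ⟨j, hj⟩ := hsub _ (hc1.union hc2)
    have hx : x₀ ∈ U j := hj (Or.inr ⟨0, by simp; positivity, hG0⟩)
    obtain ⟨G', hG', hG'0, hr⟩ := exists_isOpenEmbedding_centered (hU j) (hcell j) hx
    obtain ⟨φ, hφ, hφK⟩ := exists_homeomorph_engulf hG hG' (hG'0.trans hG0.symm)
      (a := (k : ℝ) + 1) (b := (k : ℝ) + 2) (by positivity) (by linarith) hc1
      (hr ▸ subset_union_left.trans hj) (hr ▸ subset_union_right.trans hj)
    exact ⟨⟨fun x => φ (G x), φ.isOpenEmbedding.comp hG,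
      (hφ 0 (by simp; positivity)).trans hG0⟩, hφ, hφK⟩
  choose next hnext hcover using step
  let S : ℕ → T := fun k => Nat.rec ⟨G₀, hG₀, hG₀0⟩ next k
  have hS : ∀ k, S (k + 1) = next k (S k) := fun k => rfl
  have hstab : ∀ k m : ℕ, k ≤ m → ∀ x, ‖x‖ ≤ k + 1 → (S m).1 x = (S k).1 x := by
    intro k m hkm x hx
    induction m, hkm using Nat.le_induction with
    | base => rfl
    | succ m hm ih =>
      rw [hS, hnext, ih]
      have : (k : ℝ) ≤ m := by exact_mod_cast hm
      linarith
  let G : H → X := fun x => (S ⌈‖x‖⌉₊).1 x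
  have hG : ∀ (k : ℕ) x, ‖x‖ ≤ (k : ℝ) + 1 → G x = (S k).1 x := by
    intro k x hx
    have h1 : ‖x‖ ≤ (⌈‖x‖⌉₊ : ℝ) + 1 := (Nat.le_ceil _).trans (by linarith)
    rcases le_total k ⌈‖x‖⌉₊ with h | h
    · exact hstab _ _ h x hx
    · exact (hstab _ _ h x h1).symm
  have hloc : ∀ x, ∃ k, G =ᶠ[𝓝 x] (S k).1 := by
    intro x
    obtain ⟨k, hk⟩ := exists_nat_gt ‖x‖
    refine ⟨k, ?_⟩
    have : Metric.ball (0 : H) (k + 1) ∈ 𝓝 x :=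
      Metric.isOpen_ball.mem_nhds (by rw [mem_ball_zero_iff]; linarith)
    filter_upwards [this] with y hy
    exact hG k y (mem_ball_zero_iff.1 hy).le
  have hhom : IsHomeomorph G := by
    refine ⟨?_, ?_, ?_, ?_⟩
    · rw [continuous_iff_continuousAt]
      intro x
      obtain ⟨k, hk⟩ := hloc x
      exact (S k).2.1.continuous.continuousAt.congr hk.symm
    · rw [isOpenMap_iff_nhds_le]
      intro x
      obtain ⟨k, hk⟩ := hloc x
      rw [Filter.map_congr hk, hk.eq_of_nhds]
      exact (S k).2.1.isOpenMap.nhds_le x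
    · intro x y hxy
      obtain ⟨k, hk⟩ := exists_nat_gt (max ‖x‖ ‖y‖)
      rw [hG k x (by linarith [le_max_left ‖x‖ ‖y‖]),
        hG k y (by linarith [le_max_right ‖x‖ ‖y‖])] at hxy
      exact (S k).2.1.injective hxy
    · intro y
      obtain ⟨k, hk⟩ := mem_iUnion.1 (iUnion_compactCovering X ▸ mem_univ y)
      obtain ⟨x, hx, rfl⟩ := hcover k (S k) hk
      refine ⟨x, ?_⟩
      rw [← hS]
      refine hG (k + 1) x ?_
      rw [mem_closedBall_zero_iff] at hx
      push_cast
      linarith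
  exact ⟨hhom.homeomorph G⟩

end MonotoneUnion

/-! ### Lower edges of order-convex open sets as graphs -/

section LowerEdge

variable {E : Type*} [NormedAddCommGroup E] [NormedSpace ℝ E] {C : ConvexCone ℝ E} {v : E}
  {R : Set E}

/-- Points strictly between two points of `R` belong to `R`. -/
def LLConvex (C : ConvexCone ℝ E) (R : Set E) : Prop :=
  ∀ x y z : E, x ∈ R → z ∈ R → LL C x y → LL C y z → y ∈ R

/-- The points outside `R` from which one enters `R` immediately in direction `v`. -/
def lowerEdge (v : E) (R : Set E) : Set E := {z | z ∉ R ∧ ∀ᶠ ε : ℝ in 𝓝[>] 0, z + ε • v ∈ R}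

theorem mem_of_lowerEdge_ll (hR : LLConvex C R) {z y u : E} (hz : z ∈ lowerEdge v R)
    (hzy : LL C z y) (hu : u ∈ R) (hyu : LL C y u) : y ∈ R := by
  obtain ⟨ε, h1, h2⟩ := (hz.2.and (hzy.eventually_add_smul v)).exists
  exact hR _ _ _ h1 hu h2 hyu

theorem exists_ll_of_mem_lowerEdge (hv : v ∈ interior (C : Set E)) {z : E}
    (hz : z ∈ lowerEdge v R) : ∃ u ∈ R, LL C z u := by
  obtain ⟨ε, h1, h2⟩ := (hz.2.and eventually_mem_nhdsWithin).exists
  exact ⟨_, h1, ll_add_smul hv h2 z⟩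

theorem mem_lowerEdge_of_ll (hv : v ∈ interior (C : Set E)) {z u : E} (hz : z ∉ R)
    (hzu : LL C z u) (h : ∀ y, LL C z y → LL C y u → y ∈ R) : z ∈ lowerEdge v R := by
  refine ⟨hz, ?_⟩
  filter_upwards [hzu.eventually_add_smul v, eventually_mem_nhdsWithin] with ε h1 h2
  exact h _ (ll_add_smul hv h2 z) h1

/-- Order convexity lets any approach from strictly above be replaced by the ray along `v`. Openness
excludes the points of `R`, which are approached from below inside `R`; conversely a point of `R`
below `z` would force `z ∈ R`. In particular the edge does not depend on `v`. -/
theorem lowerBoundary_eq_lowerEdge (hv : v ∈ interior (C : Set E)) (hR : IsOpen R)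
    (hconv : LLConvex C R) : lowerBoundary C R = lowerEdge v R := by
  ext z
  constructor
  · rintro ⟨⟨u, hu, hlim⟩, hno⟩
    refine mem_lowerEdge_of_ll hv (fun hz => hno ?_) (hu 0).2 fun y hzy hyu => ?_
    · have hcont : Tendsto (fun n : ℕ => z - (1 / ((n : ℝ) + 1)) • v) atTop (𝓝 z) := by
        have := (tendsto_one_div_add_atTop_nhds_zero_nat (𝕜 := ℝ)).smul_const v
        simpa using tendsto_const_nhds.sub this
      obtain ⟨N, hN⟩ := eventually_atTop.1 (hcont.eventually (hR.mem_nhds hz))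
      exact ⟨fun i => z - (1 / (((i + N : ℕ) : ℝ) + 1)) • v,
        fun i => ⟨hN _ (by omega), sub_smul_ll hv (by positivity) z⟩,
        (tendsto_add_atTop_iff_nat N).2 hcont⟩
    · obtain ⟨i, hi⟩ := (hlim.eventually ((isOpen_ll_left y).mem_nhds hzy)).exists
      exact hconv _ _ _ (hu i).1 (hu 0).1 hi hyu
  · intro hz
    obtain ⟨u, huR, hzu⟩ := exists_ll_of_mem_lowerEdge hv hz
    constructor
    · have hcont : Tendsto (fun n : ℕ => z + (1 / ((n : ℝ) + 1)) • v) atTop (𝓝 z) := by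
        have := (tendsto_one_div_add_atTop_nhds_zero_nat (𝕜 := ℝ)).smul_const v
        simpa using tendsto_const_nhds.add this
      obtain ⟨N, hN⟩ := eventually_atTop.1 (hcont.eventually ((isOpen_ll_left u).mem_nhds hzu))
      refine ⟨fun i => z + (1 / (((i + N : ℕ) : ℝ) + 1)) • v, fun i => ?_,
        (tendsto_add_atTop_iff_nat N).2 hcont⟩
      have hll := ll_add_smul hv (show 0 < 1 / (((i + N : ℕ) : ℝ) + 1) by positivity) z
      exact ⟨mem_of_lowerEdge_ll hconv hz hll huR (hN _ (by omega)), hll⟩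
    · rintro ⟨w, hw, -⟩
      exact hz.1 (hconv _ _ _ (hw 0).1 huR (hw 0).2 hzu)

/-- The edge is determined by `≪` alone, so only order preservation is needed and the image of the
ray need not be a ray. This yields invariance of the cells and transports edges along the flow. -/
theorem lowerEdge_preimage (hv : v ∈ interior (C : Set E)) (hconv : LLConvex C R) {f : E → E}
    (hf : Continuous f) (hmono : ∀ x y, LL C x y → LL C (f x) (f y)) :
    lowerEdge v (f ⁻¹' R) = f ⁻¹' lowerEdge v R := by
  ext z
  constructor
  · intro hz
    obtain ⟨u, hu, hzu⟩ := exists_ll_of_mem_lowerEdge hv hz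
    refine mem_lowerEdge_of_ll hv hz.1 (hmono _ _ hzu) fun y hzy hyu => ?_
    have h1 : Tendsto (fun ε : ℝ => f (z + ε • v)) (𝓝[>] 0) (𝓝 (f z)) :=
      (hf.tendsto z).comp (tendsto_add_smul z v)
    obtain ⟨ε, h2, h3⟩ := (hz.2.and (h1.eventually ((isOpen_ll_left y).mem_nhds hzy))).exists
    exact hconv _ _ _ h2 hu h3 hyu
  · intro hz
    obtain ⟨u, hu, hzu⟩ := exists_ll_of_mem_lowerEdge hv hz
    refine ⟨hz.1, ?_⟩
    have h1 : Tendsto (fun ε : ℝ => f (z + ε • v)) (𝓝[>] 0) (𝓝 (f z)) :=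
      (hf.tendsto z).comp (tendsto_add_smul z v)
    filter_upwards [h1.eventually ((isOpen_ll_left u).mem_nhds hzu), eventually_mem_nhdsWithin]
      with ε h2 h3
    exact mem_of_lowerEdge_ll hconv hz (hmono _ _ (ll_add_smul hv h3 z)) hu h2

theorem exists_mem_lowerEdge_segment (hR : IsOpen R) {x : E} {a b : ℝ} (hab : a ≤ b)
    (ha : x + a • v ∉ R) (hb : x + b • v ∈ R) :
    ∃ s ∈ Icc a b, x + s • v ∈ lowerEdge v R := by
  -- The last parameter outside `R` is an edge point, as everything after it lies in `R`.
  set S := Icc a b ∩ {s : ℝ | x + s • v ∉ R} with hS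
  have hcont : Continuous fun s : ℝ => x + s • v := by fun_prop
  have hcl : IsClosed S := isClosed_Icc.inter (hR.isClosed_compl.preimage hcont)
  have hbdd : BddAbove S := ⟨b, fun s hs => hs.1.2⟩
  have hmem : sSup S ∈ S := hcl.csSup_mem ⟨a, ⟨le_rfl, hab⟩, ha⟩ hbdd
  have hlt : sSup S < b := lt_of_le_of_ne hmem.1.2 fun h => hmem.2 (h ▸ hb)
  refine ⟨sSup S, hmem.1, hmem.2, ?_⟩
  filter_upwards [Ioo_mem_nhdsGT (sub_pos.2 hlt)] with ε hε
  by_contra hcon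
  have : sSup S + ε ≤ sSup S := le_csSup hbdd
    ⟨⟨by linarith [hmem.1.1, hε.1], by linarith [hε.2]⟩, by
      change x + (sSup S + ε) • v ∉ R
      rwa [add_smul, ← add_assoc]⟩
  linarith [hε.1]

theorem exists_ll_add_smul (hv : v ∈ interior (C : Set E)) (x y : E) :
    ∃ s : ℝ, 0 < s ∧ LL C x (y + s • v) := by
  have h1 := tendsto_add_smul v (y - x)
  obtain ⟨ε, h2, h3⟩ :=
    ((h1.eventually (isOpen_interior.mem_nhds hv)).and eventually_mem_nhdsWithin).exists
  have h3 : (0 : ℝ) < ε := h3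
  refine ⟨ε⁻¹, inv_pos.2 h3, ?_⟩
  have := smul_mem_interior h2 (inv_pos.2 h3)
  rw [smul_add, smul_smul, inv_mul_cancel₀ h3.ne', one_smul] at this
  unfold LL
  convert this using 1
  abel

variable {H : Type*} [NormedAddCommGroup H] [NormedSpace ℝ H] {P : E →L[ℝ] H} {i : H →L[ℝ] E}

theorem eq_of_mem_lowerEdge_of_proj_eq (hv : v ∈ interior (C : Set E)) (hconv : LLConvex C R)
    (hker : ∀ x, P x = 0 → ∃ s : ℝ, x = s • v) {z w : E} (hz : z ∈ lowerEdge v R)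
    (hw : w ∈ lowerEdge v R) (h : P z = P w) : z = w := by
  have key : ∀ z w : E, z ∈ lowerEdge v R → w ∈ lowerEdge v R → ∀ s : ℝ, 0 < s →
      w = z + s • v → False := by
    rintro z w hz hw s hs rfl
    obtain ⟨u, hu, hwu⟩ := exists_ll_of_mem_lowerEdge hv hw
    exact hw.1 (mem_of_lowerEdge_ll hconv hz (ll_add_smul hv hs z) hu hwu)
  obtain ⟨s, hs⟩ := hker (w - z) (by rw [map_sub, h, sub_self])
  rcases lt_trichotomy s 0 with hneg | rfl | hpos
  · refine (key w z hw hz (-s) (neg_pos.2 hneg) ?_).elim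
    rw [neg_smul, ← hs]
    abel
  · rw [zero_smul, sub_eq_zero] at hs
    exact hs.symm
  · refine (key z w hz hw s hpos ?_).elim
    rw [← hs]
    abel

/-- Near an edge point `z`, the line along `v` is in `R` at height `η` and outside it at height
`-η`. Both persist on nearby lines: the first since `R` is open, the second since a point of `R`
strictly below `z` would put `z` in `R`. So each nearby line crosses the edge close to `z`. -/
theorem isOpenEmbedding_proj_lowerEdge (hv : v ∈ interior (C : Set E)) (hR : IsOpen R)
    (hconv : LLConvex C R) (hPv : P v = 0) (hker : ∀ x, P x = 0 → ∃ s : ℝ, x = s • v)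
    (hPi : ∀ h, P (i h) = h) : IsOpenEmbedding fun z : lowerEdge v R => P z := by
  refine .of_continuous_injective_isOpenMap (P.continuous.comp continuous_subtype_val)
    (fun z w h => Subtype.ext (eq_of_mem_lowerEdge_of_proj_eq hv hconv hker z.2 w.2 h)) ?_
  rw [isOpenMap_iff_nhds_le]
  rintro ⟨z, hz⟩ U hU
  rw [mem_map, nhds_subtype_eq_comap, mem_comap] at hU
  obtain ⟨V, hV, hVU⟩ := hU
  obtain ⟨u, hu, hzu⟩ := exists_ll_of_mem_lowerEdge hv hz
  have hh : Tendsto (fun w : H => i (w - P z)) (𝓝 (P z)) (𝓝 0) := by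
    have : Continuous fun w : H => i (w - P z) := by fun_prop
    simpa using this.tendsto (P z)
  have hVlim : ∀ᶠ η : ℝ in 𝓝[>] 0, ∀ᶠ w in 𝓝 (P z), ∀ s ∈ Icc (-η) η,
      z + i (w - P z) + s • v ∈ V := by
    have hc : Tendsto (fun p : H × ℝ => z + i (p.1 - P z) + p.2 • v) (𝓝 (P z) ×ˢ 𝓝 0) (𝓝 z) := by
      have : Continuous fun p : H × ℝ => z + i (p.1 - P z) + p.2 • v := by fun_prop
      have := this.tendsto (P z, (0 : ℝ))
      rw [nhds_prod_eq] at this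
      simpa using this
    obtain ⟨A, hA, B, hB, hAB⟩ := mem_prod_iff.1 (hc hV)
    obtain ⟨δ, hδ, hδB⟩ := Metric.mem_nhds_iff.1 hB
    filter_upwards [Ioo_mem_nhdsGT hδ] with η hη
    filter_upwards [hA] with w hw s hs
    refine hAB (mk_mem_prod hw (hδB ?_))
    rw [mem_ball_zero_iff, Real.norm_eq_abs]
    exact (abs_le.2 hs).trans_lt hη.2
  obtain ⟨η, ⟨h1, h2⟩, h3⟩ := ((hVlim.and hz.2).and eventually_mem_nhdsWithin).exists
  have h3 : (0 : ℝ) < η := h3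
  have h4 : ∀ᶠ w in 𝓝 (P z), z + i (w - P z) + η • v ∈ R := by
    have : Tendsto (fun w : H => z + i (w - P z) + η • v) (𝓝 (P z)) (𝓝 (z + 0 + η • v)) :=
      (tendsto_const_nhds.add hh).add tendsto_const_nhds
    rw [add_zero] at this
    exact this.eventually (hR.mem_nhds h2)
  have h5 : ∀ᶠ w in 𝓝 (P z), z + i (w - P z) + (-η) • v ∉ R := by
    have : Tendsto (fun w : H => z + i (w - P z) + (-η) • v) (𝓝 (P z))
        (𝓝 (z + 0 + (-η) • v)) :=
      (tendsto_const_nhds.add hh).add tendsto_const_nhds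
    have hll : LL C (z + 0 + (-η) • v) z := by
      simpa [sub_eq_add_neg] using sub_smul_ll hv h3 z
    filter_upwards [this.eventually ((isOpen_ll_left z).mem_nhds hll)] with w hw hmem
    exact hz.1 (hconv _ _ _ hmem hu hw hzu)
  filter_upwards [h1, h4, h5] with w hw1 hw2 hw3
  obtain ⟨s, hs, hsM⟩ := exists_mem_lowerEdge_segment hR (by linarith : -η ≤ η) hw3 hw2
  have : (⟨_, hsM⟩ : lowerEdge v R) ∈ _ ⁻¹' U := hVU (show _ ∈ V from hw1 s hs)
  have hP : P (z + i (w - P z) + s • v) = w := by simp [hPi, hPv]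
  rw [mem_preimage, hP] at this
  exact this

theorem image_proj_lowerEdge (hR : IsOpen R) (hPv : P v = 0)
    (hdown : ∀ x ∈ R, ∃ s : ℝ, 0 < s ∧ x - s • v ∉ R) : P '' lowerEdge v R = P '' R := by
  ext w
  constructor
  · rintro ⟨z, hz, rfl⟩
    obtain ⟨ε, hε⟩ := hz.2.exists
    exact ⟨_, hε, by simp [hPv]⟩
  · rintro ⟨x, hx, rfl⟩
    obtain ⟨s, hs, hsR⟩ := hdown x hx
    obtain ⟨t, -, ht⟩ := exists_mem_lowerEdge_segment hR (x := x) (v := v) (a := -s) (b := 0)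
      (by linarith) (by simpa [sub_eq_add_neg] using hsR) (by simpa using hx)
    exact ⟨_, ht, by simp [hPv]⟩

/-- The lower edge of an open order-convex set is homeomorphic to the projection of the set. -/
theorem nonempty_homeomorph_lowerEdge (hv : v ∈ interior (C : Set E)) (hR : IsOpen R)
    (hconv : LLConvex C R) (hPv : P v = 0) (hker : ∀ x, P x = 0 → ∃ s : ℝ, x = s • v)
    (hPi : ∀ h, P (i h) = h) (hdown : ∀ x ∈ R, ∃ s : ℝ, 0 < s ∧ x - s • v ∉ R) :
    Nonempty (lowerEdge v R ≃ₜ P '' R) := by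
  have hemb := isOpenEmbedding_proj_lowerEdge hv hR hconv hPv hker hPi
  have hr : range (fun z : lowerEdge v R => P z) = P '' R := by
    rw [← image_proj_lowerEdge hR hPv hdown, image_eq_range]
  exact ⟨hemb.isEmbedding.toHomeomorph.trans (Homeomorph.setCongr hr)⟩

theorem exists_sub_smul_notMem_of_upper (hv : v ∈ interior (C : Set E))
    (hup : ∀ x ∈ R, ∀ y, LL C x y → y ∈ R) (hne : R ≠ univ) (x : E) :
    ∃ s : ℝ, 0 < s ∧ x - s • v ∉ R := by
  by_contra! h
  refine hne (eq_univ_of_forall fun y => ?_)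
  obtain ⟨s, hs, hll⟩ := exists_ll_add_smul hv x y
  refine hup _ (h s hs) y ?_
  unfold LL at *
  convert hll using 1
  abel

theorem image_proj_eq_univ_of_upper (hv : v ∈ interior (C : Set E))
    (hup : ∀ x ∈ R, ∀ y, LL C x y → y ∈ R) (hne : R.Nonempty) (hPv : P v = 0)
    (hPi : ∀ h, P (i h) = h) : P '' R = univ := by
  refine eq_univ_of_forall fun w => ?_
  obtain ⟨x, hx⟩ := hne
  obtain ⟨s, -, hs⟩ := exists_ll_add_smul hv x (i w)
  exact ⟨_, hup x hx _ hs, by simp [hPi, hPv]⟩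

theorem exists_projection_along [FiniteDimensional ℝ E] (hv : v ≠ 0) :
    ∃ ℓ : E →L[ℝ] ℝ, ∃ P : E →L[ℝ] LinearMap.ker (ℓ : E →ₗ[ℝ] ℝ),
      ∃ i : LinearMap.ker (ℓ : E →ₗ[ℝ] ℝ) →L[ℝ] E, P v = 0 ∧
        (∀ x, P x = 0 → ∃ s : ℝ, x = s • v) ∧ (∀ h, P (i h) = h) ∧
        Module.finrank ℝ (LinearMap.ker (ℓ : E →ₗ[ℝ] ℝ)) = Module.finrank ℝ E - 1 := by
  obtain ⟨ℓ, hℓ⟩ := SeparatingDual.exists_eq_one (R := ℝ) hv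
  have hmem : ∀ x, x - ℓ x • v ∈ LinearMap.ker (ℓ : E →ₗ[ℝ] ℝ) := fun x => by
    simp [hℓ]
  let P := (ContinuousLinearMap.id ℝ E - ℓ.smulRight v).codRestrict _ hmem
  have hP : ∀ x, (P x : E) = x - ℓ x • v := fun x => rfl
  refine ⟨ℓ, P, Submodule.subtypeL _, ?_, ?_, ?_, ?_⟩
  · apply Subtype.ext
    rw [hP, hℓ, one_smul, sub_self, Submodule.coe_zero]
  · intro x hx
    refine ⟨ℓ x, ?_⟩
    have := hP x
    rwa [hx, Submodule.coe_zero, eq_comm, sub_eq_zero] at this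
  · rintro ⟨h, hh⟩
    apply Subtype.ext
    have : ℓ h = 0 := hh
    rw [hP]
    simp [this]
  · have hr := LinearMap.finrank_range_add_finrank_ker (ℓ : E →ₗ[ℝ] ℝ)
    have : LinearMap.range (ℓ : E →ₗ[ℝ] ℝ) = ⊤ := by
      refine LinearMap.range_eq_top.2 fun a => ⟨a • v, ?_⟩
      simp [hℓ]
    rw [this, finrank_top, Module.finrank_self] at hr
    omega

theorem nonempty_homeomorph_of_convex [FiniteDimensional ℝ H] {S : Set H} (hconv : Convex ℝ S)
    (hopen : IsOpen S) (hne : S.Nonempty) (hb : Bornology.IsBounded S) : Nonempty (H ≃ₜ S) := by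
  obtain ⟨h, h1, -⟩ := exists_homeomorph_image_interior_closure_frontier_eq_unitBall hconv
    (by rwa [hopen.interior_eq]) hb
  rw [hopen.interior_eq] at h1
  exact ⟨Homeomorph.unitBall.trans ((h.image S).trans (Homeomorph.setCongr h1)).symm⟩

end LowerEdge

section Cluster

variable {X ι : Type*} [TopologicalSpace X] {l : Filter ι} {f : ι → X} {b : X}

theorem _root_.IsClosed.mem_of_mapClusterPt_of_eventually {S : Set X} (hS : IsClosed S) (hb : MapClusterPt b l f)
    (h : ∀ᶠ i in l, f i ∈ S) : b ∈ S := by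
  by_contra hcon
  obtain ⟨i, h1, h2⟩ := ((hb.frequently (hS.isOpen_compl.mem_nhds hcon)).and_eventually h).exists
  exact h1 h2

theorem eq_of_mapClusterPt_of_tendsto [T2Space X] {q : X} (hb : MapClusterPt b l f)
    (hq : Tendsto f l (𝓝 q)) : b = q := by
  by_contra hne
  obtain ⟨U, V, hU, hV, hbU, hqV, hdisj⟩ := t2_separation hne
  obtain ⟨i, h1, h2⟩ := ((hb.frequently (hU.mem_nhds hbU)).and_eventually
    (hq.eventually (hV.mem_nhds hqV))).exists
  exact hdisj.notMem_of_mem_left h1 h2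

end Cluster

/-! ### The time-reversed flow -/

variable {E : Type*} [NormedAddCommGroup E] [NormedSpace ℝ E]

/-- A strongly monotone flow with a compact invariant set outside of which all orbits tend to
infinity: the time reversal of a dissipative strongly competitive flow. -/
structure MonotoneRepeller (C : ConvexCone ℝ E) (Ψ : Flow ℝ E) (Γ : Set E) : Prop where
  cone : IsSolidCone C
  mono : ∀ x y : E, ∀ t : ℝ, 0 < t → Lt C x y → LL C (Ψ t x) (Ψ t y)
  nonempty : Γ.Nonempty
  compact : IsCompact Γ
  inv : ∀ (t : ℝ), ∀ x ∈ Γ, Ψ t x ∈ Γ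
  escape : ∀ x ∉ Γ, Tendsto (fun t : ℝ => ‖Ψ t x‖) atTop atTop

section Flow

variable {Ψ : Flow ℝ E} {x y q : E}

theorem flow_neg_flow (t : ℝ) (x : E) : Ψ (-t) (Ψ t x) = x := by
  rw [← Ψ.map_add, neg_add_cancel, Ψ.map_zero_apply]

theorem flow_flow_neg (t : ℝ) (x : E) : Ψ t (Ψ (-t) x) = x := by
  rw [← Ψ.map_add, add_neg_cancel, Ψ.map_zero_apply]

theorem flow_injective (t : ℝ) : Function.Injective (Ψ t) := (Ψ.toHomeomorph t).injective

theorem continuous_flow (t : ℝ) : Continuous (Ψ t) := Ψ.continuous_toFun t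

theorem continuous_flow_time (x : E) : Continuous fun t : ℝ => Ψ t x :=
  Ψ.continuous continuous_id continuous_const

theorem tendsto_shift_iff {α : Type*} (f : E → α) (s : ℝ) (x : E) (l : Filter α) :
    Tendsto (fun t : ℝ => f (Ψ t (Ψ s x))) atTop l ↔ Tendsto (fun t : ℝ => f (Ψ t x)) atTop l := by
  have h : (fun t : ℝ => f (Ψ t (Ψ s x))) = (fun t => f (Ψ t x)) ∘ fun t => t + s :=
    funext fun t => by simp [Ψ.map_add]
  constructor
  · intro h1
    have := h1.comp (tendsto_atTop_add_const_right atTop (-s) tendsto_id)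
    refine this.congr fun t => ?_
    simp [← Ψ.map_add]
  · intro h1
    rw [h]
    exact h1.comp (tendsto_atTop_add_const_right atTop s tendsto_id)

theorem eventually_shift_iff (p : E → Prop) (s : ℝ) (x : E) :
    (∀ᶠ t : ℝ in atTop, p (Ψ t (Ψ s x))) ↔ ∀ᶠ t : ℝ in atTop, p (Ψ t x) := by
  have := tendsto_shift_iff (Ψ := Ψ) p s x (𝓟 {True})
  simpa [tendsto_principal] using this

theorem mem_equilibria_of_tendsto (h : Tendsto (fun t : ℝ => Ψ t x) atTop (𝓝 q)) :
    q ∈ equilibria Ψ := by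
  intro s
  have h1 : Tendsto (fun t : ℝ => Ψ s (Ψ t x)) atTop (𝓝 (Ψ s q)) :=
    ((continuous_flow s).tendsto q).comp h
  have h2 : Tendsto (fun t : ℝ => Ψ t (Ψ s x)) atTop (𝓝 q) :=
    (tendsto_shift_iff (fun z => z) s x (𝓝 q)).2 h
  refine tendsto_nhds_unique h1 (h2.congr fun t => ?_)
  rw [← Ψ.map_add, ← Ψ.map_add, add_comm]

theorem isClosed_equilibria : IsClosed (equilibria Ψ) := by
  have : equilibria Ψ = ⋂ t : ℝ, {p | Ψ t p = p} := by
    ext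
    simp [equilibria]
  rw [this]
  exact isClosed_iInter fun t => isClosed_eq (continuous_flow t) continuous_id

/-- An open, transitive, flow-invariant relation between `y` and `Ψ T y` for one `T > 0` holds
for all large times. -/
theorem exists_forall_ge_rel {r : E → E → Prop} (htrans : ∀ x y z, r x y → r y z → r x z)
    (hmono : ∀ x y, ∀ t : ℝ, 0 ≤ t → r x y → r (Ψ t x) (Ψ t y)) (hopen : ∀ y, IsOpen {x | r y x})
    {T : ℝ} (hT : 0 < T) (h : r y (Ψ T y)) : ∃ T' : ℝ, ∀ t, T' ≤ t → r y (Ψ t y) := by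
  have hiter : ∀ u : ℝ, 0 ≤ u → r y (Ψ u y) → ∀ n : ℕ, r y (Ψ ((n + 1 : ℕ) * u) y) := by
    intro u hu hr n
    induction n with
    | zero => simpa using hr
    | succ n ih =>
      have := htrans _ _ _ hr (hmono _ _ u hu ih)
      rw [← Ψ.map_add] at this
      convert this using 2
      push_cast
      ring
  have hnhds : {t : ℝ | r y (Ψ t y)} ∈ 𝓝 T :=
    ((hopen y).preimage (continuous_flow_time y)).mem_nhds h
  obtain ⟨σ, hσ, hball⟩ := Metric.nhds_basis_closedBall.mem_iff.1 hnhds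
  obtain ⟨N, hN⟩ := exists_nat_ge (T / σ)
  refine ⟨(N + 1) * T, fun t ht => ?_⟩
  have hnt : (N : ℝ) + 1 ≤ t / T := (le_div_iff₀ hT).2 ht
  -- A large `t` is `n` steps of length `t / n`, which lies in `[T, T + σ]`, where the relation
  -- still holds by openness.
  set n := ⌊t / T⌋₊ with hn
  have hNn : N + 1 ≤ n := Nat.le_floor (by push_cast; exact hnt)
  have hn1 : (n : ℝ) ≤ t / T := Nat.floor_le (by linarith [Nat.cast_nonneg (α := ℝ) N])
  have hn2 : t / T < n + 1 := Nat.lt_floor_add_one _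
  have hnpos : (0 : ℝ) < n := by exact_mod_cast (by omega : 0 < n)
  rw [le_div_iff₀ hT] at hn1
  rw [div_lt_iff₀ hT] at hn2
  have hσn : T ≤ n * σ := by
    rw [div_le_iff₀ hσ] at hN
    have : (N : ℝ) ≤ n := by exact_mod_cast (by omega : N ≤ n)
    nlinarith
  have hu1 : T ≤ t / n := (le_div_iff₀ hnpos).2 (by linarith)
  have hu2 : t / n ≤ T + σ := (div_le_iff₀ hnpos).2 (by nlinarith)
  have hmem : r y (Ψ (t / n) y) := hball (by
    rw [Metric.mem_closedBall, Real.dist_eq, abs_le]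
    constructor <;> linarith)
  have := hiter _ (hT.le.trans hu1) hmem (n - 1)
  rw [Nat.sub_add_cancel (by omega : 1 ≤ n), mul_div_cancel₀ _ hnpos.ne'] at this
  exact this

end Flow

/-! ### Squeezing and convergence of monotone orbits -/

namespace MonotoneRepeller

variable {C : ConvexCone ℝ E} {Ψ : Flow ℝ E} {Γ : Set E} {x y z q v : E}

theorem mono_le (S : MonotoneRepeller C Ψ Γ) {t : ℝ} (ht : 0 ≤ t) (h : Le C x y) :
    Le C (Ψ t x) (Ψ t y) := by
  rcases ht.eq_or_lt with rfl | ht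
  · simpa [Ψ.map_zero] using h
  by_cases hxy : x = y
  · rw [hxy]
    exact S.cone.le_refl _
  · exact (S.mono x y t ht (lt_iff.2 ⟨h, hxy⟩)).le

theorem mono_ll [Nontrivial E] (S : MonotoneRepeller C Ψ Γ) {t : ℝ} (ht : 0 ≤ t)
    (h : LL C x y) : LL C (Ψ t x) (Ψ t y) := by
  rcases ht.eq_or_lt with rfl | ht
  · simpa [Ψ.map_zero] using h
  · exact S.mono x y t ht (h.lt S.cone)

theorem ll_of_le_of_ne (S : MonotoneRepeller C Ψ Γ) {t : ℝ} (ht : 0 < t) (h : Le C x y)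
    (hne : x ≠ y) : LL C (Ψ t x) (Ψ t y) :=
  S.mono x y t ht (lt_iff.2 ⟨h, hne⟩)

/-- The relation `≪` between `x` and `y` follows from `≤` one time unit earlier. -/
theorem ll_of_le_neg_one (S : MonotoneRepeller C Ψ Γ) (h : Le C (Ψ (-1) x) (Ψ (-1) y))
    (hne : x ≠ y) : LL C x y := by
  have := S.ll_of_le_of_ne one_pos h fun h => hne (flow_injective _ h)
  rwa [flow_flow_neg, flow_flow_neg] at this

theorem ll_of_equilibria (S : MonotoneRepeller C Ψ Γ) (hx : x ∈ equilibria Ψ)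
    (hy : y ∈ equilibria Ψ) (h : Le C x y) (hne : x ≠ y) : LL C x y := by
  refine S.ll_of_le_neg_one ?_ hne
  rwa [hx, hy]

theorem mem_of_frequently_norm_le (S : MonotoneRepeller C Ψ Γ) {K : ℝ}
    (h : ∃ᶠ t : ℝ in atTop, ‖Ψ t x‖ ≤ K) : x ∈ Γ := by
  by_contra hx
  obtain ⟨t, h1, h2⟩ := (h.and_eventually ((S.escape x hx).eventually_gt_atTop K)).exists
  exact absurd h1 h2.not_ge

theorem mem_of_mapClusterPt (S : MonotoneRepeller C Ψ Γ)
    (h : MapClusterPt q atTop fun t : ℝ => Ψ t x) : x ∈ Γ := by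
  refine S.mem_of_frequently_norm_le (K := ‖q‖ + 1) ?_
  refine (h.frequently (Metric.ball_mem_nhds q one_pos)).mono fun t ht => ?_
  have ht : ‖Ψ t x - q‖ < 1 := by rwa [← dist_eq_norm]
  have := norm_sub_norm_le (Ψ t x) q
  linarith

theorem mem_of_tendsto (S : MonotoneRepeller C Ψ Γ)
    (h : Tendsto (fun t : ℝ => Ψ t x) atTop (𝓝 q)) : x ∈ Γ :=
  S.mem_of_mapClusterPt h.mapClusterPt

theorem exists_norm_le (S : MonotoneRepeller C Ψ Γ) : ∃ K : ℝ, ∀ x ∈ Γ, ∀ t : ℝ, ‖Ψ t x‖ ≤ K := by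
  obtain ⟨K, hK⟩ := S.compact.isBounded.exists_norm_le
  exact ⟨K, fun x hx t => hK _ (S.inv t x hx)⟩

theorem not_tendsto_norm_atTop (S : MonotoneRepeller C Ψ Γ) (hx : x ∈ Γ) :
    ¬ Tendsto (fun t : ℝ => ‖Ψ t x‖) atTop atTop := by
  intro h
  obtain ⟨K, hK⟩ := S.exists_norm_le
  obtain ⟨t, ht⟩ := (h.eventually_gt_atTop K).exists
  exact absurd (hK x hx t) ht.not_ge

theorem mem_of_mem_mapClusterPt (S : MonotoneRepeller C Ψ Γ) (hx : x ∈ Γ)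
    (h : MapClusterPt q atTop fun t : ℝ => Ψ t x) : q ∈ Γ :=
  IsClosed.mem_of_mapClusterPt_of_eventually S.compact.isClosed h
    (Eventually.of_forall fun t => S.inv t x hx)

theorem exists_mapClusterPt (S : MonotoneRepeller C Ψ Γ) (hx : x ∈ Γ) {l : Filter ℝ} [l.NeBot] :
    ∃ b ∈ Γ, MapClusterPt b l fun t : ℝ => Ψ t x :=
  S.compact.exists_mapClusterPt (tendsto_principal.2 (Eventually.of_forall fun t => S.inv t x hx))

/-- An orbit squeezed between two orbits with a common limit converges to that limit. -/
theorem tendsto_of_between [FiniteDimensional ℝ E] (S : MonotoneRepeller C Ψ Γ)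
    (hxy : Le C x y) (hyz : Le C y z) (hx : Tendsto (fun t : ℝ => Ψ t x) atTop (𝓝 q))
    (hz : Tendsto (fun t : ℝ => Ψ t z) atTop (𝓝 q)) :
    Tendsto (fun t : ℝ => Ψ t y) atTop (𝓝 q) := by
  obtain ⟨κ, hκ, hn⟩ := S.cone.exists_normal
  have h1 : Tendsto (fun t : ℝ => κ * ‖Ψ t z - Ψ t x‖) atTop (𝓝 0) := by
    have := ((hz.sub hx).norm).const_mul κ
    simpa using this
  have h2 : Tendsto (fun t : ℝ => Ψ t y - Ψ t x) atTop (𝓝 0) := by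
    refine squeeze_zero_norm' ?_ h1
    filter_upwards [eventually_ge_atTop 0] with t ht
    exact hn _ _ _ (S.mono_le ht hxy) (S.mono_le ht hyz)
  simpa using h2.add hx

theorem mem_of_between [FiniteDimensional ℝ E] (S : MonotoneRepeller C Ψ Γ)
    (hxy : Le C x y) (hyz : Le C y z) (hx : x ∈ Γ) (hz : z ∈ Γ) : y ∈ Γ := by
  obtain ⟨κ, hκ, hn⟩ := S.cone.exists_normal
  obtain ⟨K, hK⟩ := S.exists_norm_le
  refine S.mem_of_frequently_norm_le (K := κ * (K + K) + K) (Eventually.frequently ?_)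
  filter_upwards [eventually_ge_atTop 0] with t ht
  have h1 := hn _ _ _ (S.mono_le ht hxy) (S.mono_le ht hyz)
  have h2 := norm_sub_le (Ψ t z) (Ψ t x)
  have h3 := norm_le_norm_sub_add (Ψ t y) (Ψ t x)
  have h4 := hK x hx t
  have h5 := hK z hz t
  have h6 : κ * ‖Ψ t z - Ψ t x‖ ≤ κ * (K + K) := by gcongr; linarith
  linarith

theorem eventually_ge_of_ll [Nontrivial E] (S : MonotoneRepeller C Ψ Γ) {T : ℝ} (hT : 0 < T)
    (h : LL C y (Ψ T y)) : ∃ T' : ℝ, ∀ t, T' ≤ t → LL C y (Ψ t y) :=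
  exists_forall_ge_rel (r := LL C) (fun _ _ _ => LL.trans) (fun _ _ _ ht h => S.mono_ll ht h)
    isOpen_ll_right hT h

theorem eventually_le_of_ll [Nontrivial E] (S : MonotoneRepeller C Ψ Γ) {T : ℝ} (hT : 0 < T)
    (h : LL C (Ψ T y) y) : ∃ T' : ℝ, ∀ t, T' ≤ t → LL C (Ψ t y) y :=
  exists_forall_ge_rel (r := fun a b => LL C b a) (fun _ _ _ h1 h2 => h2.trans h1)
    (fun _ _ _ ht h => S.mono_ll ht h) isOpen_ll_left hT h

/-- Convergence criterion: a bounded orbit passing strictly above its starting point converges. -/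
theorem exists_tendsto_of_ll [Nontrivial E] (S : MonotoneRepeller C Ψ Γ) (hy : y ∈ Γ) {T : ℝ}
    (hT : 0 < T) (h : LL C y (Ψ T y)) : ∃ q, Tendsto (fun t : ℝ => Ψ t y) atTop (𝓝 q) := by
  obtain ⟨T', hT'⟩ := S.eventually_ge_of_ll hT h
  -- For fixed `s`, the point at time `s` is below all points at times `t ≥ s + T'`. Letting `t`,
  -- then `s`, run along the two limits gives `a ≤ b`; by symmetry the cluster point is unique.
  have hle : ∀ a b, MapClusterPt a atTop (fun t : ℝ => Ψ t y) →
      MapClusterPt b atTop (fun t : ℝ => Ψ t y) → Le C a b := by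
    intro a b ha hb
    refine IsClosed.mem_of_mapClusterPt_of_eventually (S := {x | Le C x b})
      (S.cone.isClosed_le_left b) ha ?_
    filter_upwards [eventually_ge_atTop 0] with s hs
    refine IsClosed.mem_of_mapClusterPt_of_eventually (S := {x | Le C (Ψ s y) x})
      (S.cone.isClosed_le_right (Ψ s y)) hb ?_
    filter_upwards [eventually_ge_atTop (s + T')] with t ht
    have := S.mono_le hs (hT' (t - s) (by linarith)).le
    rwa [← Ψ.map_add, add_sub_cancel] at this
  obtain ⟨q, -, hq⟩ := S.exists_mapClusterPt hy (l := atTop)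
  exact ⟨q, S.compact.tendsto_nhds_of_unique_mapClusterPt
    (Eventually.of_forall fun t => S.inv t y hy)
    fun b _ hb => S.cone.le_antisymm (hle _ _ hb hq) (hle _ _ hq hb)⟩

theorem tendsto_of_ll_mapClusterPt [Nontrivial E] (S : MonotoneRepeller C Ψ Γ) {b : E}
    (hb : MapClusterPt b atTop fun t : ℝ => Ψ t y) (h : LL C y b) :
    Tendsto (fun t : ℝ => Ψ t y) atTop (𝓝 b) := by
  obtain ⟨T, h1, h2⟩ := ((hb.frequently ((isOpen_ll_right y).mem_nhds h)).and_eventually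
    (eventually_gt_atTop 0)).exists
  obtain ⟨q, hq⟩ := S.exists_tendsto_of_ll (S.mem_of_mapClusterPt hb) h2 h1
  rwa [eq_of_mapClusterPt_of_tendsto hb hq]

end MonotoneRepeller

/-- The points attracted to `+∞`, above all lower bounds of `Γ`. -/
def topBasin (C : ConvexCone ℝ E) (Ψ : Flow ℝ E) (Γ : Set E) : Set E :=
  {x | Tendsto (fun t : ℝ => ‖Ψ t x‖) atTop atTop ∧
    ∀ᶠ t : ℝ in atTop, AboveLowerBounds C Γ (Ψ t x)}

/-- The points attracted from below by an end, which is an equilibrium or `+∞`. -/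
def basin (C : ConvexCone ℝ E) (Ψ : Flow ℝ E) (Γ : Set E) : Option E → Set E
  | none => interior (topBasin C Ψ Γ)
  | some q => {x | Tendsto (fun t : ℝ => Ψ t x) atTop (𝓝 q) ∧ ∀ᶠ t : ℝ in atTop, LL C (Ψ t x) q}

/-! ### Basins of the ends, and their lower edges as cells -/

namespace MonotoneRepeller

variable {C : ConvexCone ℝ E} {Ψ : Flow ℝ E} {Γ : Set E} {x y z q v : E} {o o' : Option E}

theorem flow_mem_topBasin_iff (s : ℝ) : Ψ s x ∈ topBasin C Ψ Γ ↔ x ∈ topBasin C Ψ Γ :=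
  and_congr (tendsto_shift_iff _ s x _) (eventually_shift_iff _ s x)

theorem flow_mem_basin_iff (s : ℝ) : Ψ s x ∈ basin C Ψ Γ o ↔ x ∈ basin C Ψ Γ o := by
  rcases o with _ | q
  · have key : ∀ (s : ℝ) (x : E), Ψ s x ∈ interior (topBasin C Ψ Γ) →
        x ∈ interior (topBasin C Ψ Γ) := by
      intro s x hx
      have : Ψ s ⁻¹' interior (topBasin C Ψ Γ) ⊆ interior (topBasin C Ψ Γ) :=
        interior_maximal (fun y hy => (flow_mem_topBasin_iff s).1 (interior_subset hy))
          (isOpen_interior.preimage (continuous_flow s))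
      exact this hx
    refine ⟨key s x, fun h => key (-s) _ ?_⟩
    rwa [flow_neg_flow]
  · exact and_congr (tendsto_shift_iff (fun z => z) s x _)
      (eventually_shift_iff (fun z => LL C z q) s x)

theorem basin_some_subset (S : MonotoneRepeller C Ψ Γ) : basin C Ψ Γ (some q) ⊆ Γ :=
  fun _ hx => S.mem_of_tendsto hx.1

theorem notMem_basin_none (S : MonotoneRepeller C Ψ Γ) (hx : x ∈ Γ) : x ∉ basin C Ψ Γ none :=
  fun h => S.not_tendsto_norm_atTop hx (interior_subset h).1

theorem basin_disjoint (S : MonotoneRepeller C Ψ Γ) (h : x ∈ basin C Ψ Γ o)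
    (h' : x ∈ basin C Ψ Γ o') : o = o' := by
  rcases o with _ | q <;> rcases o' with _ | q'
  · rfl
  · exact (S.notMem_basin_none (S.basin_some_subset h') h).elim
  · exact (S.notMem_basin_none (S.basin_some_subset h) h').elim
  · rw [tendsto_nhds_unique h.1 h'.1]

variable [Nontrivial E] [FiniteDimensional ℝ E]

theorem mem_basin_of_between (S : MonotoneRepeller C Ψ Γ) (hq : q ∈ equilibria Ψ)
    (hx : Tendsto (fun t : ℝ => Ψ t x) atTop (𝓝 q)) (hxy : Le C x y) (hyq : LL C y q) :
    y ∈ basin C Ψ Γ (some q) := by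
  have hq' : Tendsto (fun t : ℝ => Ψ t q) atTop (𝓝 q) :=
    tendsto_const_nhds.congr fun t => (hq t).symm
  refine ⟨S.tendsto_of_between hxy hyq.le hx hq', ?_⟩
  filter_upwards [eventually_ge_atTop 0] with t ht
  have := S.mono_ll ht hyq
  rwa [hq t] at this

/-- Eventually `a ≤ Ψ t x ≤ Ψ t y` for a fixed lower bound `a` of `Γ`, so normality of the cone
makes `Ψ t y` at least as large as a multiple of `Ψ t x`, up to a constant. This is why `R₋(+∞)`
asks for more than unboundedness. -/
theorem topBasin_upper (S : MonotoneRepeller C Ψ Γ) (hx : x ∈ topBasin C Ψ Γ) (hxy : Le C x y) :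
    y ∈ topBasin C Ψ Γ := by
  obtain ⟨w, hw⟩ := S.cone.solid
  obtain ⟨a, ha⟩ := exists_forall_le hw S.compact.isBounded
  obtain ⟨κ, hκ, hn⟩ := S.cone.exists_normal
  constructor
  · have h1 : Tendsto (fun t : ℝ => (‖Ψ t x‖ - (‖a‖ + κ * ‖a‖)) / κ) atTop atTop :=
      (tendsto_atTop_add_const_right _ _ hx.1).atTop_div_const hκ
    refine tendsto_atTop_mono' _ ?_ h1
    filter_upwards [hx.2, eventually_ge_atTop 0] with t h2 ht
    have h3 := hn _ _ _ (h2 a ha).le (S.mono_le ht hxy)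
    have h4 := norm_le_norm_sub_add (Ψ t x) a
    have h5 : κ * ‖Ψ t y - a‖ ≤ κ * (‖Ψ t y‖ + ‖a‖) := by gcongr; exact norm_sub_le _ _
    rw [div_le_iff₀ hκ]
    linarith
  · filter_upwards [hx.2, eventually_ge_atTop 0] with t h2 ht
    exact fun b hb => (h2 b hb).trans_le (S.mono_le ht hxy)

theorem basin_none_upper (S : MonotoneRepeller C Ψ Γ) (hx : x ∈ basin C Ψ Γ none)
    (hxy : Le C x y) : y ∈ basin C Ψ Γ none := by
  have : (fun w => w - (y - x)) ⁻¹' interior (topBasin C Ψ Γ) ⊆ interior (topBasin C Ψ Γ) := by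
    refine interior_maximal (fun w hw => S.topBasin_upper (interior_subset hw) ?_)
      (isOpen_interior.preimage (by fun_prop))
    unfold Le at *
    rwa [sub_sub_cancel]
  exact this (by rw [mem_preimage, sub_sub_cancel]; exact hx)

theorem llConvex_basin (S : MonotoneRepeller C Ψ Γ) : LLConvex C (basin C Ψ Γ o) := by
  intro x y z hx hz hxy hyz
  rcases o with _ | q
  · exact S.basin_none_upper hx hxy.le
  · refine ⟨S.tendsto_of_between hxy.le hyz.le hx.1 hz.1, ?_⟩
    filter_upwards [hz.2, eventually_ge_atTop 0] with t h1 ht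
    exact (S.mono_ll ht hyz).trans h1

/-- A point of the basin of `q` from which one moves up after some time. -/
theorem exists_ll_flow (hx : x ∈ basin C Ψ Γ (some q)) :
    ∃ p ∈ basin C Ψ Γ (some q), ∃ s : ℝ, 0 < s ∧ LL C p (Ψ s p) ∧ LL C (Ψ s p) q ∧
      ∃ T : ℝ, p = Ψ T x := by
  obtain ⟨T, hT⟩ := hx.2.exists
  have hp : Ψ T x ∈ basin C Ψ Γ (some q) := (flow_mem_basin_iff T).2 hx
  obtain ⟨s, ⟨h1, h2⟩, h3⟩ := (((hp.1.eventually ((isOpen_ll_right _).mem_nhds hT)).and hp.2).and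
    (eventually_gt_atTop 0)).exists
  exact ⟨_, hp, s, h3, h1, h2, T, rfl⟩

/-- The orbit of a basin point passes through some `p` and later a point strictly between `p` and
`q`. The open order interval from `p` to `q` is squeezed into the basin, and the flow pulls it back
to a neighborhood of the starting point. -/
theorem isOpen_basin (S : MonotoneRepeller C Ψ Γ) : IsOpen (basin C Ψ Γ o) := by
  rcases o with _ | q
  · exact isOpen_interior
  rw [isOpen_iff_mem_nhds]
  intro x hx
  obtain ⟨p, hp, s, hs, h1, h2, T, rfl⟩ := exists_ll_flow hx
  rw [← Ψ.map_add] at h1 h2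
  have hopen : IsOpen (Ψ (s + T) ⁻¹' ({y | LL C (Ψ T x) y} ∩ {y | LL C y q})) :=
    ((isOpen_ll_right _).inter (isOpen_ll_left _)).preimage (continuous_flow _)
  filter_upwards [hopen.mem_nhds ⟨h1, h2⟩] with y hy
  rw [← flow_mem_basin_iff (s + T)]
  exact S.mem_basin_of_between (mem_equilibria_of_tendsto hx.1) hp.1 hy.1.le hy.2

theorem exists_sub_smul_notMem_of_isBounded (hv : v ≠ 0) {R : Set E} (hR : Bornology.IsBounded R)
    (x : E) : ∃ s : ℝ, 0 < s ∧ x - s • v ∉ R := by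
  obtain ⟨K, hK⟩ := hR.exists_norm_le
  have hv' := norm_pos_iff.2 hv
  refine ⟨(|K| + ‖x‖ + 1) / ‖v‖, by positivity, fun h => ?_⟩
  have h1 := hK _ h
  have h2 := norm_sub_norm_le (((|K| + ‖x‖ + 1) / ‖v‖) • v) x
  rw [norm_smul, Real.norm_of_nonneg (by positivity), div_mul_cancel₀ _ hv'.ne',
    norm_sub_rev] at h2
  linarith [le_abs_self K]

theorem interior_ne_zero (S : MonotoneRepeller C Ψ Γ) (hv : v ∈ interior (C : Set E)) :
    v ≠ 0 := by
  rintro rfl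
  exact S.cone.not_ll_self 0 (by rwa [LL, sub_zero])

theorem exists_sub_smul_notMem_basin (S : MonotoneRepeller C Ψ Γ)
    (hv : v ∈ interior (C : Set E)) (x : E) : ∃ s : ℝ, 0 < s ∧ x - s • v ∉ basin C Ψ Γ o := by
  rcases o with _ | q
  · refine exists_sub_smul_notMem_of_upper hv (fun x hx y hxy => S.basin_none_upper hx hxy.le)
      (fun h => ?_) x
    obtain ⟨γ, hγ⟩ := S.nonempty
    exact S.notMem_basin_none hγ (h ▸ mem_univ γ)
  · exact exists_sub_smul_notMem_of_isBounded (S.interior_ne_zero hv)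
      (S.compact.isBounded.subset S.basin_some_subset) x

theorem flow_mem_cell_iff (S : MonotoneRepeller C Ψ Γ) (hv : v ∈ interior (C : Set E)) (t : ℝ) :
    Ψ t z ∈ lowerEdge v (basin C Ψ Γ o) ↔ z ∈ lowerEdge v (basin C Ψ Γ o) := by
  have key : ∀ (t : ℝ), 0 ≤ t → ∀ z, Ψ t z ∈ lowerEdge v (basin C Ψ Γ o) ↔
      z ∈ lowerEdge v (basin C Ψ Γ o) := by
    intro t ht z
    have h1 := lowerEdge_preimage hv (S.llConvex_basin (o := o)) (continuous_flow t)
      fun x y h => S.mono_ll ht h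
    have h2 : Ψ t ⁻¹' basin C Ψ Γ o = basin C Ψ Γ o := ext fun x => flow_mem_basin_iff t
    rw [h2] at h1
    exact (Set.ext_iff.1 h1 z).symm
  rcases le_total 0 t with ht | ht
  · exact key t ht z
  · have := key (-t) (neg_nonneg.2 ht) (Ψ t z)
    rw [flow_neg_flow] at this
    exact this.symm

theorem cell_not_ll (S : MonotoneRepeller C Ψ Γ) (hv : v ∈ interior (C : Set E)) {w : E}
    (hz : z ∈ lowerEdge v (basin C Ψ Γ o)) (hw : w ∈ lowerEdge v (basin C Ψ Γ o)) :
    ¬ LL C z w := by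
  intro h
  obtain ⟨u, hu, hwu⟩ := exists_ll_of_mem_lowerEdge hv hw
  exact hw.1 (mem_of_lowerEdge_ll S.llConvex_basin hz h hu hwu)

/-- After one time unit `≤` between distinct points becomes `≪`, the cell is invariant, and `≪`
inside it would put the upper point into the basin. -/
theorem cell_unordered (S : MonotoneRepeller C Ψ Γ) (hv : v ∈ interior (C : Set E)) :
    Unordered C (lowerEdge v (basin C Ψ Γ o)) := by
  intro z hz w hw h
  by_contra hne
  exact S.cell_not_ll hv ((S.flow_mem_cell_iff hv 1).2 hz) ((S.flow_mem_cell_iff hv 1).2 hw)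
    (S.ll_of_le_of_ne one_pos h hne)

theorem cell_disjoint (S : MonotoneRepeller C Ψ Γ) (hz : z ∈ lowerEdge v (basin C Ψ Γ o))
    (hz' : z ∈ lowerEdge v (basin C Ψ Γ o')) : o = o' := by
  obtain ⟨ε, h1, h2⟩ := (hz.2.and hz'.2).exists
  exact S.basin_disjoint h1 h2

theorem countable_basin_nonempty (S : MonotoneRepeller C Ψ Γ) :
    {o : Option E | (basin C Ψ Γ o).Nonempty}.Countable := by
  have : ProperSpace E := FiniteDimensional.proper_real E
  refine Set.PairwiseDisjoint.countable_of_isOpen (s := basin C Ψ Γ) ?_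
    (fun o _ => S.isOpen_basin) fun o ho => ho
  intro o _ o' _ hne
  exact Set.disjoint_left.2 fun x hx hx' => hne (S.basin_disjoint hx hx')

theorem nonempty_basin_of_nonempty_cell (h : (lowerEdge v (basin C Ψ Γ o)).Nonempty) :
    (basin C Ψ Γ o).Nonempty := by
  obtain ⟨z, hz⟩ := h
  obtain ⟨ε, hε⟩ := hz.2.exists
  exact ⟨_, hε⟩

section Cell

variable {H : Type*} [NormedAddCommGroup H] [NormedSpace ℝ H] [FiniteDimensional ℝ H]
  {P : E →L[ℝ] H} {i : H →L[ℝ] E}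

/-- The projection of the basin of an equilibrium is an increasing union of open cells. -/
theorem nonempty_homeomorph_image_basin (S : MonotoneRepeller C Ψ Γ)
    (hv : v ∈ interior (C : Set E)) (hPv : P v = 0)
    (hker : ∀ x, P x = 0 → ∃ s : ℝ, x = s • v) (hPi : ∀ h, P (i h) = h)
    (hne : (basin C Ψ Γ (some q)).Nonempty) :
    Nonempty (H ≃ₜ P '' basin C Ψ Γ (some q)) := by
  have : ProperSpace E := FiniteDimensional.proper_real E
  have : ProperSpace H := FiniteDimensional.proper_real H
  obtain ⟨x, hx⟩ := hne
  have hq : q ∈ equilibria Ψ := mem_equilibria_of_tendsto hx.1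
  obtain ⟨p, hp, T, hT, hpT, hTq, -⟩ := exists_ll_flow hx
  have hPopen : IsOpenMap P := P.isOpenMap fun h => ⟨i h, hPi h⟩
  set Q : Set E := {x | LL C p x} ∩ {x | LL C x q} with hQ
  have hQopen : IsOpen Q := (isOpen_ll_right p).inter (isOpen_ll_left q)
  have hQconv : LLConvex C Q := fun x y z hx hz hxy hyz => ⟨hx.1.trans hxy, hyz.trans hz.2⟩
  have hQsub : Q ⊆ basin C Ψ Γ (some q) := fun y hy => S.mem_basin_of_between hq hp.1 hy.1.le hy.2
  -- Since `p ≪ Ψ T p` and `q` is fixed, `Q` is mapped into itself at time `T`, so the `A k`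
  -- increase; every basin orbit ends up in `Q`, so they exhaust the basin.
  let A : ℕ → Set E := fun k => Ψ (k * T) ⁻¹' Q
  have hk : ∀ k : ℕ, (0 : ℝ) ≤ k * T := fun k => by positivity
  have hAopen : ∀ k, IsOpen (A k) := fun k => hQopen.preimage (continuous_flow _)
  have hAconv : ∀ k, LLConvex C (A k) := fun k x y z hx hz hxy hyz =>
    hQconv _ _ _ hx hz (S.mono_ll (hk k) hxy) (S.mono_ll (hk k) hyz)
  have hAsub : ∀ k, A k ⊆ basin C Ψ Γ (some q) := fun k y hy =>
    (flow_mem_basin_iff (k * T)).1 (hQsub hy)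
  have hAmono : Monotone A := by
    refine monotone_nat_of_le_succ fun k y hy => ?_
    have h1 : Ψ ((k + 1 : ℕ) * T) y = Ψ T (Ψ (k * T) y) := by
      rw [← Ψ.map_add]
      congr 1
      push_cast
      ring
    change Ψ ((k + 1 : ℕ) * T) y ∈ Q
    rw [h1]
    refine ⟨hpT.trans (S.mono_ll hT.le hy.1), ?_⟩
    have := S.mono_ll hT.le hy.2
    rwa [hq T] at this
  have hAun : basin C Ψ Γ (some q) ⊆ ⋃ k, A k := by
    intro y hy
    have h0 : LL C p q := hpT.trans hTq
    have h1 : ∀ᶠ t : ℝ in atTop, Ψ t y ∈ Q :=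
      (hy.1.eventually ((isOpen_ll_right p).mem_nhds h0)).and hy.2
    have h2 : Tendsto (fun k : ℕ => (k : ℝ) * T) atTop atTop :=
      tendsto_natCast_atTop_atTop.atTop_mul_const hT
    obtain ⟨k, hk⟩ := (h2.eventually h1).exists
    exact mem_iUnion.2 ⟨k, hk⟩
  have hdown : ∀ R ⊆ basin C Ψ Γ (some q), ∀ x ∈ R, ∃ s : ℝ, 0 < s ∧ x - s • v ∉ R := by
    intro R hR x _
    obtain ⟨s, hs, h⟩ := S.exists_sub_smul_notMem_basin (o := some q) hv x
    exact ⟨s, hs, fun h' => h (hR h')⟩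
  have hQcell : Nonempty (H ≃ₜ P '' Q) := by
    refine nonempty_homeomorph_of_convex ?_ (hPopen _ hQopen) ⟨_, Ψ T p, ⟨hpT, hTq⟩, rfl⟩ ?_
    · have hCconv : Convex ℝ (interior (C : Set E)) := C.convex.interior
      have hQc : Convex ℝ Q := by
        intro a ha b hb α β hα hβ hαβ
        obtain rfl : α = 1 - β := by linarith
        constructor
        · change (1 - β) • a + β • b - p ∈ interior (C : Set E)
          convert hCconv ha.1 hb.1 hα hβ hαβ using 1
          module
        · change q - ((1 - β) • a + β • b) ∈ interior (C : Set E)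
          convert hCconv ha.2 hb.2 hα hβ hαβ using 1
          module
      exact hQc.linear_image (P : E →ₗ[ℝ] H)
    · exact P.lipschitz.isBounded_image
        (S.compact.isBounded.subset (hQsub.trans S.basin_some_subset))
  -- `A k` need not be convex. Its projection is compared with the convex projection of `Q` through
  -- the two edges, which the homeomorphism `Ψ (k * T)` identifies.
  have hAcell : ∀ k, Nonempty (H ≃ₜ P '' A k) := by
    intro k
    obtain ⟨e₁⟩ := hQcell
    obtain ⟨e₂⟩ := nonempty_homeomorph_lowerEdge hv hQopen hQconv hPv hker hPi (hdown Q hQsub)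
    obtain ⟨e₃⟩ := nonempty_homeomorph_lowerEdge hv (hAopen k) (hAconv k) hPv hker hPi
      (hdown _ (hAsub k))
    have h1 : lowerEdge v (A k) = Ψ (k * T) ⁻¹' lowerEdge v Q :=
      lowerEdge_preimage hv hQconv (continuous_flow _) fun x y h => S.mono_ll (hk k) h
    have h2 : (Ψ.toHomeomorph (k * T)) '' lowerEdge v (A k) = lowerEdge v Q := by
      rw [h1]
      exact image_preimage_eq _ (Ψ.toHomeomorph (k * T)).surjective
    exact ⟨e₁.trans (e₂.symm.trans
      ((((Ψ.toHomeomorph (k * T)).image _).trans (Homeomorph.setCongr h2)).symm.trans e₃))⟩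
  have hXopen : IsOpen (P '' basin C Ψ Γ (some q)) := hPopen _ S.isOpen_basin
  have : LocallyCompactSpace (P '' basin C Ψ Γ (some q)) := hXopen.locallyCompactSpace
  refine nonempty_homeomorph_of_monotone_union
    (U := fun k => (Subtype.val ⁻¹' (P '' A k) : Set (P '' basin C Ψ Γ (some q))))
    (fun k => (hPopen _ (hAopen k)).preimage continuous_subtype_val)
    (fun k l hkl => preimage_mono (image_mono (hAmono hkl))) ?_ fun k => ?_
  · refine eq_univ_of_forall ?_
    rintro ⟨_, y, hy, rfl⟩
    obtain ⟨k, hk⟩ := mem_iUnion.1 (hAun hy)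
    exact mem_iUnion.2 ⟨k, y, hk, rfl⟩
  · obtain ⟨e⟩ := hAcell k
    have hval : Subtype.val '' (Subtype.val ⁻¹' (P '' A k) : Set (P '' basin C Ψ Γ (some q))) =
        P '' A k := by
      rw [Subtype.image_preimage_coe]
      exact inter_eq_right.2 (image_mono (hAsub k))
    exact ⟨e.trans ((IsEmbedding.subtypeVal.homeomorphImage _).trans
      (Homeomorph.setCongr hval)).symm⟩

theorem nonempty_homeomorph_cell (S : MonotoneRepeller C Ψ Γ)
    (hv : v ∈ interior (C : Set E)) (hPv : P v = 0)
    (hker : ∀ x, P x = 0 → ∃ s : ℝ, x = s • v) (hPi : ∀ h, P (i h) = h)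
    (hne : (basin C Ψ Γ o).Nonempty) :
    Nonempty (lowerEdge v (basin C Ψ Γ o) ≃ₜ H) := by
  obtain ⟨e⟩ := nonempty_homeomorph_lowerEdge hv (S.isOpen_basin (o := o)) S.llConvex_basin hPv
    hker hPi fun x _ => S.exists_sub_smul_notMem_basin hv x
  rcases o with _ | q
  · have : P '' basin C Ψ Γ none = univ := image_proj_eq_univ_of_upper hv
      (fun x hx y hxy => S.basin_none_upper hx hxy.le) hne hPv hPi
    exact ⟨e.trans ((Homeomorph.setCongr this).trans (Homeomorph.Set.univ H))⟩
  · obtain ⟨e'⟩ := S.nonempty_homeomorph_image_basin hv hPv hker hPi hne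
    exact ⟨e.trans e'.symm⟩

theorem isOpenCell_cell (S : MonotoneRepeller C Ψ Γ) (hv : v ∈ interior (C : Set E))
    (hne : (basin C Ψ Γ o).Nonempty) :
    IsOpenCell (Module.finrank ℝ E - 1) (lowerEdge v (basin C Ψ Γ o)) := by
  obtain ⟨ℓ, P, i, hPv, hker, hPi, hrank⟩ := exists_projection_along (S.interior_ne_zero hv)
  obtain ⟨e⟩ := S.nonempty_homeomorph_cell hv hPv hker hPi hne
  have : Module.finrank ℝ (LinearMap.ker (ℓ : E →ₗ[ℝ] ℝ)) =
      Module.finrank ℝ (EuclideanSpace ℝ (Fin (Module.finrank ℝ E - 1))) := by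
    rw [hrank, finrank_euclideanSpace_fin]
  exact ⟨e.trans (ContinuousLinearEquiv.ofFinrankEq this).toHomeomorph⟩

end Cell

end MonotoneRepeller

/-- The omega limit points of `y`. -/
def omegaPts (Ψ : Flow ℝ E) (y : E) : Set E := {b | MapClusterPt b atTop fun t : ℝ => Ψ t y}

/-- A point that is one of its own omega limit points. -/
def Recurrent (Ψ : Flow ℝ E) (y : E) : Prop := MapClusterPt y atTop fun t : ℝ => Ψ t y

/-- A closed invariant set with a dense set of recurrent points. -/
structure RecurrentSet (Ψ : Flow ℝ E) (L : Set E) : Prop where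
  isClosed : IsClosed L
  inv : ∀ (t : ℝ), ∀ x ∈ L, Ψ t x ∈ L
  dense : L ⊆ closure {y | Recurrent Ψ y}

/-- `x` and `y` are not related by `≤`. -/
def Unrelated (C : ConvexCone ℝ E) (x y : E) : Prop := ¬ Le C x y ∧ ¬ Le C y x

/-- The points `b` such that the whole orbit of `x` is below the whole orbit of `b`. -/
def orbitUpper (C : ConvexCone ℝ E) (Ψ : Flow ℝ E) (x : E) : Set E :=
  {b | ∀ τ s : ℝ, Le C (Ψ s x) (Ψ τ b)}

/-! ### Recurrence and connectedness tools -/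

section Recurrence

variable {Ψ : Flow ℝ E} {x y : E}

theorem omegaPts_eq_singleton_of_tendsto {q b : E} (h : Tendsto (fun t : ℝ => Ψ t y) atTop (𝓝 q))
    (hb : b ∈ omegaPts Ψ y) : b = q :=
  eq_of_mapClusterPt_of_tendsto hb h

theorem isClosed_omegaPts (y : E) : IsClosed (omegaPts Ψ y) := isClosed_setOfPred_clusterPt

theorem flow_mem_omegaPts (s : ℝ) {b : E} (hb : b ∈ omegaPts Ψ y) : Ψ s b ∈ omegaPts Ψ y := by
  rw [omegaPts, mem_ofPred_eq, mapClusterPt_iff_ultrafilter] at hb ⊢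
  obtain ⟨U, hU, hlim⟩ := hb
  refine ⟨U.map (fun t => s + t), (map_mono hU).trans
    (tendsto_atTop_add_const_left atTop s tendsto_id), ?_⟩
  refine tendsto_map'_iff.2 ?_
  have := ((continuous_flow (Ψ := Ψ) s).tendsto b).comp hlim
  refine this.congr fun t => ?_
  simp [Ψ.map_add]

theorem Recurrent.flow (hx : Recurrent Ψ x) (s : ℝ) : Recurrent Ψ (Ψ s x) := by
  have h := hx.continuousAt_comp (continuous_flow (Ψ := Ψ) s).continuousAt
  have he : (Ψ s ∘ fun t : ℝ => Ψ t x) = fun t : ℝ => Ψ t (Ψ s x) := by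
    funext t
    simp [← Ψ.map_add, add_comm]
  rw [he] at h
  exact h

/-- A recurrent orbit that enters a forward invariant set stays there, and its starting point is a
limit of later positions. Density extends this from recurrent points to `L`. -/
theorem RecurrentSet.mem_closure_of_flow_mem {L O : Set E} (hL : RecurrentSet Ψ L)
    (hO : IsOpen O) (hfwd : ∀ t : ℝ, 0 ≤ t → ∀ w ∈ O, Ψ t w ∈ O) (hx : x ∈ L) {s : ℝ}
    (h : Ψ s x ∈ O) : x ∈ closure O := by
  have hsub : {y | Recurrent Ψ y} ∩ Ψ s ⁻¹' O ⊆ closure O := by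
    rintro y ⟨hy, hyO⟩
    refine isClosed_closure.mem_of_mapClusterPt_of_eventually hy ?_
    filter_upwards [eventually_ge_atTop s] with t ht
    have := hfwd (t - s) (by linarith) _ hyO
    rw [← Ψ.map_add, sub_add_cancel] at this
    exact subset_closure this
  have hopen : IsOpen (Ψ s ⁻¹' O) := hO.preimage (continuous_flow s)
  have : x ∈ closure ({y | Recurrent Ψ y} ∩ Ψ s ⁻¹' O) := by
    rw [inter_comm]
    exact hopen.inter_closure ⟨h, hL.dense hx⟩
  exact closure_minimal hsub isClosed_closure this

theorem subset_of_isPreconnected_of_eventually {X : Type*} [TopologicalSpace X] {A B : Set X}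
    (hB : IsPreconnected B) (hne : (B ∩ A).Nonempty)
    (h1 : ∀ x ∈ B, x ∈ A → ∀ᶠ y in 𝓝 x, y ∈ B → y ∈ A)
    (h2 : ∀ x ∈ B, x ∉ A → ∀ᶠ y in 𝓝 x, y ∈ B → y ∉ A) : B ⊆ A := by
  have : PreconnectedSpace B := isPreconnected_iff_preconnectedSpace.1 hB
  have hclopen : IsClopen (Subtype.val ⁻¹' A : Set B) := by
    constructor
    · rw [← isOpen_compl_iff, isOpen_iff_mem_nhds]
      rintro ⟨x, hx⟩ hxA
      filter_upwards [continuous_subtype_val.continuousAt.eventually (h2 x hx hxA)] with y hy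
      exact hy y.2
    · rw [isOpen_iff_mem_nhds]
      rintro ⟨x, hx⟩ hxA
      filter_upwards [continuous_subtype_val.continuousAt.eventually (h1 x hx hxA)] with y hy
      exact hy y.2
  obtain ⟨x, hxB, hxA⟩ := hne
  have := hclopen.eq_univ ⟨⟨x, hxB⟩, hxA⟩
  exact fun y hy => (this ▸ mem_univ (⟨y, hy⟩ : B) : (⟨y, hy⟩ : B) ∈ (Subtype.val ⁻¹' A : Set B))

end Recurrence

theorem eventually_forall_ll_of_isCompact {C : ConvexCone ℝ E} {K : Set E} {x : E}
    (hK : IsCompact K) (h : ∀ k ∈ K, LL C x k) : ∀ᶠ w in 𝓝 x, ∀ k ∈ K, LL C w k :=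
  hK.eventually_forall_of_forall_eventually fun k hk => isOpen_ll.mem_nhds (h k hk)

/-! ### Recurrent points in a monotone flow -/

namespace MonotoneRepeller

variable {C : ConvexCone ℝ E} {Ψ : Flow ℝ E} {Γ L B : Set E} {x y z q v u e e' : E}
  {o o' : Option E}

theorem isCompact_omegaPts (S : MonotoneRepeller C Ψ Γ) (hy : y ∈ Γ) :
    IsCompact (omegaPts Ψ y) :=
  S.compact.of_isClosed_subset (isClosed_omegaPts y) fun _ hb => S.mem_of_mem_mapClusterPt hy hb

theorem le_of_tendsto_of_mem_omegaPts (S : MonotoneRepeller C Ψ Γ)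
    (hx : Tendsto (fun t : ℝ => Ψ t x) atTop (𝓝 q)) (hb : z ∈ omegaPts Ψ y) (h : Le C x y) :
    Le C q z := by
  obtain ⟨U, hU, hlim⟩ := mapClusterPt_iff_ultrafilter.1 hb
  refine S.cone.le_of_tendsto (hx.mono_left hU) hlim (Eventually.frequently ?_)
  exact Eventually.filter_mono hU (by
    filter_upwards [eventually_ge_atTop (0 : ℝ)] with t ht using S.mono_le ht h)

variable [Nontrivial E]

/-- Otherwise, after time `1`, the orbit passes strictly above (for `r < 0`, strictly below) its own
position and by monotonicity ratchets away from it for good, contradicting recurrence. -/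
theorem _root_.CompetitiveFlow.Recurrent.flow_eq_of_le (hx : Recurrent Ψ x)
    (S : MonotoneRepeller C Ψ Γ) {r : ℝ} (h : Le C x (Ψ r x)) : Ψ r x = x := by
  by_contra hne
  rcases le_total 0 r with hr | hr
  · have hr : 0 < r := lt_of_le_of_ne hr fun h0 => hne (by rw [← h0, Ψ.map_zero_apply])
    have h1 := S.ll_of_le_of_ne one_pos h (Ne.symm hne)
    rw [← Ψ.map_add, add_comm, Ψ.map_add] at h1
    obtain ⟨T', hT'⟩ := S.eventually_ge_of_ll hr h1
    have h2 : Le C (Ψ r (Ψ 1 x)) (Ψ 1 x) := by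
      refine IsClosed.mem_of_mapClusterPt_of_eventually (S := {w | Le C (Ψ r (Ψ 1 x)) w})
        (S.cone.isClosed_le_right _) (hx.flow 1) ?_
      filter_upwards [eventually_ge_atTop (r + T')] with t ht
      have := S.mono_le hr.le (hT' (t - r) (by linarith)).le
      rwa [← Ψ.map_add r (t - r), add_sub_cancel] at this
    exact h1.not_le S.cone h2
  · have hr : 0 < -r := by
      rcases hr.eq_or_lt with h0 | h0
      · exact (hne (by rw [h0, Ψ.map_zero_apply])).elim
      · linarith
    have h1 := S.ll_of_le_of_ne (show 0 < 1 + -r by linarith) h (Ne.symm hne)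
    have e1 : Ψ (1 + -r) (Ψ r x) = Ψ 1 x := by
      rw [← Ψ.map_add]
      congr 1
      ring
    rw [e1, add_comm, Ψ.map_add] at h1
    obtain ⟨T', hT'⟩ := S.eventually_le_of_ll hr h1
    have h2 : Le C (Ψ 1 x) (Ψ (-r) (Ψ 1 x)) := by
      refine IsClosed.mem_of_mapClusterPt_of_eventually (S := {w | Le C w (Ψ (-r) (Ψ 1 x))})
        (S.cone.isClosed_le_left _) (hx.flow 1) ?_
      filter_upwards [eventually_ge_atTop (-r + T')] with t ht
      have := S.mono_le hr.le (hT' (t + r) (by linarith)).le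
      rwa [← Ψ.map_add (-r) (t + r), neg_add_cancel_comm_assoc] at this
    exact h1.not_le S.cone h2

/-- Along a recurrent orbit, strict domination at one time is eventually domination up to any
time shift. -/
theorem exists_forall_ge_shift_ll (S : MonotoneRepeller C Ψ Γ) (hx : Recurrent Ψ x)
    (hxy : LL C x y) {U : Ultrafilter ℝ} (hU : (U : Filter ℝ) ≤ atTop)
    (hUx : Tendsto (fun t : ℝ => Ψ t x) U (𝓝 x)) {b : E}
    (hUy : Tendsto (fun t : ℝ => Ψ t y) U (𝓝 b)) (r : ℝ) :
    ∃ T : ℝ, ∀ t, T ≤ t → LL C (Ψ (t + r) x) (Ψ t y) := by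
  have hpers : ∀ r T : ℝ, LL C (Ψ (T + r) x) (Ψ T y) →
      ∀ t, T ≤ t → LL C (Ψ (t + r) x) (Ψ t y) := by
    intro r T h t ht
    have := S.mono_ll (sub_nonneg.2 ht) h
    rw [← Ψ.map_add, ← Ψ.map_add] at this
    convert this using 2 <;> ring
  -- The admissible shifts form a nonempty clopen subset of the line.
  let A : Set ℝ := {r | ∃ T : ℝ, LL C (Ψ (T + r) x) (Ψ T y)}
  suffices hA : A = univ by
    obtain ⟨T, hT⟩ : r ∈ A := hA ▸ mem_univ r
    exact ⟨T, hpers r T hT⟩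
  have h0 : (0 : ℝ) ∈ A := ⟨0, by rwa [add_zero, Ψ.map_zero_apply, Ψ.map_zero_apply]⟩
  have hshift : ∀ r, Tendsto (fun t : ℝ => Ψ (t + r) x) U (𝓝 (Ψ r x)) := fun r => by
    have := ((continuous_flow (Ψ := Ψ) r).tendsto x).comp hUx
    refine this.congr fun t => ?_
    simp [← Ψ.map_add, add_comm]
  have hle : ∀ r ∈ A, Le C (Ψ r x) b := by
    rintro r ⟨T, hT⟩
    refine S.cone.le_of_tendsto (hshift r) hUy (Eventually.frequently (Eventually.filter_mono hU ?_))
    filter_upwards [eventually_ge_atTop T] with t ht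
    exact (hpers r T hT t ht).le
  have hopen : IsOpen A := by
    have : A = ⋃ T : ℝ, {r | LL C (Ψ (T + r) x) (Ψ T y)} := by
      ext
      simp [A]
    rw [this]
    exact isOpen_iUnion fun T => (isOpen_ll_left (Ψ T y)).preimage
      ((continuous_flow_time x).comp (continuous_const.add continuous_id))
  -- A limit shift `r` satisfies `Ψ r x ≤ b`. If equality holds, then `x ≤ Ψ r x`, so `r` is a
  -- period of `x` and acts like shift `0`. Otherwise `≪` holds one time unit later and, being open,
  -- passes back from the limit to actual times.
  have hclosed : IsClosed A := by
    refine isClosed_of_closure_subset fun r hr => ?_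
    have hrb : Le C (Ψ r x) b :=
      closure_minimal hle ((S.cone.isClosed_le_left b).preimage (continuous_flow_time x)) hr
    by_cases hne : Ψ r x = b
    · have hxr : Le C x (Ψ r x) := by
        have := hle 0 h0
        rwa [Ψ.map_zero_apply, ← hne] at this
      have := hx.flow_eq_of_le S hxr
      exact ⟨0, by rwa [zero_add, Ψ.map_zero_apply, this]⟩
    · have h1 := S.ll_of_le_of_ne one_pos hrb hne
      have h2 : Tendsto (fun t : ℝ => Ψ 1 (Ψ (t + r) x)) U (𝓝 (Ψ 1 (Ψ r x))) :=
        ((continuous_flow 1).tendsto _).comp (hshift r)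
      have h3 : Tendsto (fun t : ℝ => Ψ 1 (Ψ t y)) U (𝓝 (Ψ 1 b)) :=
        ((continuous_flow 1).tendsto _).comp hUy
      obtain ⟨t, ht⟩ := (h1.eventually h2 h3).exists
      refine ⟨1 + t, ?_⟩
      rwa [← Ψ.map_add, ← Ψ.map_add, ← add_assoc] at ht
  exact IsClopen.eq_univ ⟨hclosed, hopen⟩ ⟨0, h0⟩

theorem exists_mem_orbitUpper_of_recurrent (S : MonotoneRepeller C Ψ Γ) (hx : Recurrent Ψ x)
    (hxy : LL C x y) (hy : y ∈ Γ) : ∃ b ∈ omegaPts Ψ y, b ∈ orbitUpper C Ψ x := by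
  obtain ⟨U, hU, hUx⟩ := mapClusterPt_iff_ultrafilter.1 hx
  obtain ⟨b, -, hb⟩ := S.compact.ultrafilter_le_nhds (U.map fun t : ℝ => Ψ t y)
    (tendsto_principal.2 (Eventually.of_forall fun t => S.inv t y hy))
  have hUy : Tendsto (fun t : ℝ => Ψ t y) U (𝓝 b) := hb
  refine ⟨b, mapClusterPt_iff_ultrafilter.2 ⟨U, hU, hUy⟩, fun τ s => ?_⟩
  obtain ⟨T, hT⟩ := S.exists_forall_ge_shift_ll hx hxy hU hUx hUy (s - τ)
  refine S.cone.le_of_tendsto (((continuous_flow s).tendsto x).comp hUx)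
    (((continuous_flow τ).tendsto b).comp hUy) (Eventually.frequently (Eventually.filter_mono hU ?_))
  filter_upwards [eventually_ge_atTop (T - τ)] with t ht
  have := (hT (τ + t) (by linarith)).le
  simp only [Function.comp_apply]
  rw [← Ψ.map_add, ← Ψ.map_add]
  convert this using 2
  ring

theorem isClosed_orbitUpper (S : MonotoneRepeller C Ψ Γ) :
    IsClosed {p : E × E | p.2 ∈ orbitUpper C Ψ p.1} := by
  have : {p : E × E | p.2 ∈ orbitUpper C Ψ p.1} =
      ⋂ τ : ℝ, ⋂ s : ℝ, {p : E × E | Le C (Ψ s p.1) (Ψ τ p.2)} := by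
    ext
    simp [orbitUpper]
  rw [this]
  exact isClosed_iInter fun τ => isClosed_iInter fun s => S.cone.isClosed_le.preimage
    (((continuous_flow s).comp continuous_fst).prodMk ((continuous_flow τ).comp continuous_snd))

/-- Recurrent points `w` near `x` are still strictly below the same `y`. Their omega limit points
above lie in one compact set, and the relation `orbitUpper` is closed, so a limit serves for `x`. -/
theorem exists_mem_orbitUpper (S : MonotoneRepeller C Ψ Γ) (hL : RecurrentSet Ψ L)
    (hx : x ∈ L) (hxy : LL C x y) (hy : y ∈ Γ) :
    ∃ b ∈ omegaPts Ψ y, b ∈ orbitUpper C Ψ x := by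
  obtain ⟨U, hrec, hU⟩ := mem_closure_iff_ultrafilter.1 (hL.dense hx)
  have hev : ∀ᶠ w in (U : Filter E), ∃ b ∈ omegaPts Ψ y, b ∈ orbitUpper C Ψ w := by
    filter_upwards [hrec, hU ((isOpen_ll_left y).mem_nhds hxy)] with w hw hwy
    exact S.exists_mem_orbitUpper_of_recurrent hw hwy hy
  choose! b hb hbu using fun w (h : ∃ b ∈ omegaPts Ψ y, b ∈ orbitUpper C Ψ w) => h
  obtain ⟨c, hc, hlim⟩ := (S.isCompact_omegaPts hy).ultrafilter_le_nhds (U.map b)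
    (tendsto_principal.2 (hev.mono hb))
  refine ⟨c, hc, ?_⟩
  exact S.isClosed_orbitUpper.mem_of_tendsto
    ((show Tendsto id (U : Filter E) (𝓝 x) from hU).prodMk_nhds hlim) (hev.mono hbu)

theorem ll_of_mem_orbitUpper (S : MonotoneRepeller C Ψ Γ) {b : E} (hb : b ∈ orbitUpper C Ψ x)
    (hne : x ≠ b) : LL C x b := S.ll_of_le_neg_one (hb (-1) (-1)) hne

theorem mem_equilibria_of_mem_orbitUpper_self (S : MonotoneRepeller C Ψ Γ)
    (hx : x ∈ orbitUpper C Ψ x) : x ∈ equilibria Ψ := fun t => by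
  have h1 := hx 0 t
  have h2 := hx t 0
  rw [Ψ.map_zero_apply] at h1 h2
  exact S.cone.le_antisymm h1 h2

variable [FiniteDimensional ℝ E]

theorem subset_of_recurrentSet (S : MonotoneRepeller C Ψ Γ) (hL : RecurrentSet Ψ L) : L ⊆ Γ :=
  hL.dense.trans (closure_minimal (fun _ hy => S.mem_of_mapClusterPt hy) S.compact.isClosed)

/-- The open basin of `q` would contain a recurrent point; converging to `q`, it equals `q`, but
basin orbits are eventually strictly below `q`. -/
theorem notMem_basin (S : MonotoneRepeller C Ψ Γ) (hL : RecurrentSet Ψ L) (hx : x ∈ L) :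
    x ∉ basin C Ψ Γ o := by
  rcases o with _ | q
  · exact S.notMem_basin_none (S.subset_of_recurrentSet hL hx)
  · intro h
    obtain ⟨y, hy, hrec⟩ := mem_closure_iff.1 (hL.dense hx) _ S.isOpen_basin h
    obtain rfl := eq_of_mapClusterPt_of_tendsto hrec hy.1
    obtain ⟨t, ht⟩ := hy.2.exists
    rw [mem_equilibria_of_tendsto hy.1 t] at ht
    exact S.cone.not_ll_self y ht

/-- `x` is accumulated by omega limit points of points directly above `x`. -/
def SoftAbove (Ψ : Flow ℝ E) (Γ : Set E) (v x : E) : Prop :=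
  ∀ N ∈ 𝓝 x, ∃ ε : ℝ, 0 < ε ∧ x + ε • v ∈ Γ ∧ ∃ b ∈ N, b ∈ omegaPts Ψ (x + ε • v)

theorem mem_cell_none_of_forall_notMem (S : MonotoneRepeller C Ψ Γ)
    (hv : v ∈ interior (C : Set E)) (hx : x ∈ Γ) (h : ∀ ε : ℝ, 0 < ε → x + ε • v ∉ Γ) :
    x ∈ lowerEdge v (basin C Ψ Γ none) := by
  refine ⟨S.notMem_basin_none hx, ?_⟩
  filter_upwards [eventually_mem_nhdsWithin] with ε (hε : 0 < ε)
  have hsub : {w | LL C (x + (ε / 2) • v) w} ⊆ topBasin C Ψ Γ := by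
    intro w hw
    refine S.topBasin_upper ⟨S.escape _ (h _ (half_pos hε)), ?_⟩ hw.le
    filter_upwards [eventually_ge_atTop 0] with t ht a ha
    exact (ha _ (S.inv t x hx)).trans_LL (S.mono_ll ht (ll_add_smul hv (half_pos hε) x))
  exact interior_maximal hsub (isOpen_ll_right _) (add_smul_ll_add_smul hv (half_lt_self hε) x)

theorem mem_cell_or_softAbove (S : MonotoneRepeller C Ψ Γ) (hv : v ∈ interior (C : Set E))
    (hL : RecurrentSet Ψ L) (hx : x ∈ L) :
    (∃ o, x ∈ lowerEdge v (basin C Ψ Γ o)) ∨ (x ∈ equilibria Ψ ∧ SoftAbove Ψ Γ v x) := by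
  have hxΓ := S.subset_of_recurrentSet hL hx
  by_cases hΓ : ∃ ε : ℝ, 0 < ε ∧ x + ε • v ∈ Γ
  swap
  · push Not at hΓ
    exact Or.inl ⟨none, S.mem_cell_none_of_forall_notMem hv hxΓ hΓ⟩
  obtain ⟨ε₀, hε₀, hΓ⟩ := hΓ
  have hmem : ∀ ε : ℝ, 0 < ε → ε ≤ ε₀ → x + ε • v ∈ Γ := by
    intro ε hε hle
    rcases hle.eq_or_lt with rfl | hlt
    · exact hΓ
    · exact S.mem_of_between (ll_add_smul hv hε x).le (add_smul_ll_add_smul hv hlt x).le hxΓ hΓ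
  have hex : ∀ ε : ℝ, 0 < ε → ε ≤ ε₀ →
      ∃ b ∈ omegaPts Ψ (x + ε • v), b ∈ orbitUpper C Ψ x := fun ε hε hle =>
    S.exists_mem_orbitUpper hL hx (ll_add_smul hv hε x) (hmem ε hε hle)
  -- If omega limit points stay uniformly above `x + δ • v`, then all points `x + ε • v` with `ε ≤
  -- δ` converge upward. Comparing limits in both directions shows that the limit is the same
  -- equilibrium `q`, so `x` is on the edge of its basin.
  by_cases hgap : ∃ δ : ℝ, 0 < δ ∧ δ ≤ ε₀ ∧ ∀ ε : ℝ, 0 < ε → ε ≤ δ →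
      ∃ b ∈ omegaPts Ψ (x + ε • v), LL C (x + δ • v) b
  · left
    obtain ⟨δ, hδ, hδε, hgap⟩ := hgap
    have hle : ∀ ε : ℝ, ε ≤ δ → Le C (x + ε • v) (x + δ • v) := by
      intro ε h
      rcases h.eq_or_lt with rfl | h
      · exact S.cone.le_refl _
      · exact (add_smul_ll_add_smul hv h x).le
    obtain ⟨q, hq, hδq⟩ := hgap δ hδ le_rfl
    have hqlim := S.tendsto_of_ll_mapClusterPt hq hδq
    have hqE := mem_equilibria_of_tendsto hqlim
    refine ⟨some q, S.notMem_basin hL hx, ?_⟩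
    filter_upwards [Ioc_mem_nhdsGT hδ] with ε hε
    obtain ⟨b, hb, hδb⟩ := hgap ε hε.1 hε.2
    have hblim := S.tendsto_of_ll_mapClusterPt hb ((hle ε hε.2).trans_LL hδb)
    have hbE := mem_equilibria_of_tendsto hblim
    have h1 : Le C b q := S.le_of_tendsto_of_mem_omegaPts hblim hq (hle ε hε.2)
    have h2 : Le C q b := by
      refine S.le_of_tendsto_of_mem_omegaPts (y := b) hqlim ?_ hδb.le
      exact (tendsto_const_nhds.congr fun t => (hbE t).symm : Tendsto (fun t : ℝ => Ψ t b)
        atTop (𝓝 b)).mapClusterPt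
    obtain rfl := S.cone.le_antisymm h1 h2
    exact S.mem_basin_of_between hbE hblim (S.cone.le_refl _) ((hle ε hε.2).trans_LL hδb)
  · right
    push Not at hgap
    -- The points of `Γ` in `orbitUpper C Ψ x` outside `N` form a compact set strictly above `x`,
    -- hence above `x + δ • v` for small `δ`; the absence of a gap forces a limit point into `N`.
    -- The choice `N = ∅`, allowed if `x` is not an equilibrium, gives a contradiction.
    have key : ∀ N : Set E, IsOpen N → (x ∈ equilibria Ψ → x ∈ N) →
        ∃ ε : ℝ, 0 < ε ∧ x + ε • v ∈ Γ ∧ ∃ b ∈ N, b ∈ omegaPts Ψ (x + ε • v) := by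
      intro N hN hxN
      have hZ : IsCompact ((Γ ∩ orbitUpper C Ψ x) \ N) := by
        refine IsCompact.diff (S.compact.inter_right ?_) hN
        exact S.isClosed_orbitUpper.preimage (Continuous.prodMk_right x)
      have hll : ∀ k ∈ (Γ ∩ orbitUpper C Ψ x) \ N, LL C x k := by
        rintro k ⟨⟨-, hk⟩, hkN⟩
        refine S.ll_of_mem_orbitUpper hk ?_
        rintro rfl
        exact hkN (hxN (S.mem_equilibria_of_mem_orbitUpper_self hk))
      obtain ⟨δ, h1, hδ⟩ := ((((tendsto_add_smul x v).eventually
        (eventually_forall_ll_of_isCompact hZ hll))).and (Ioc_mem_nhdsGT hε₀)).exists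
      obtain ⟨ε, hε, hεδ, hno⟩ := hgap δ hδ.1 hδ.2
      have hεΓ := hmem ε hε (hεδ.trans hδ.2)
      obtain ⟨b, hb, hbu⟩ := hex ε hε (hεδ.trans hδ.2)
      refine ⟨ε, hε, hεΓ, b, ?_, hb⟩
      by_contra hbN
      exact hno b hb (h1 b ⟨⟨S.mem_of_mem_mapClusterPt hεΓ hb, hbu⟩, hbN⟩)
    constructor
    · by_contra hxE
      obtain ⟨-, -, -, b, hb, -⟩ := key ∅ isOpen_empty fun h => (hxE h).elim
      exact hb
    · intro N hN
      obtain ⟨N', hN', hopen, hxN'⟩ := mem_nhds_iff.1 hN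
      obtain ⟨ε, hε, hΓ, b, hb, hb'⟩ := key N' hopen fun _ => hxN'
      exact ⟨ε, hε, hΓ, b, hN' hb, hb'⟩

end MonotoneRepeller

/-! ### Connected subsets of a recurrent set -/

namespace MonotoneRepeller

variable {C : ConvexCone ℝ E} {Ψ : Flow ℝ E} {Γ L B : Set E} {x y z q v u w e e' : E}
  {o o' : Option E} [Nontrivial E] [FiniteDimensional ℝ E]

theorem mem_equilibria_of_mem_cell (hz : z ∈ lowerEdge v (basin C Ψ Γ (some q))) :
    q ∈ equilibria Ψ := by
  obtain ⟨x, hx⟩ := nonempty_basin_of_nonempty_cell ⟨z, hz⟩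
  exact mem_equilibria_of_tendsto hx.1

theorem mem_of_mem_equilibria (S : MonotoneRepeller C Ψ Γ) (hq : q ∈ equilibria Ψ) : q ∈ Γ :=
  S.mem_of_tendsto (tendsto_const_nhds.congr fun t => (hq t).symm)

theorem mem_omegaPts_self (hq : q ∈ equilibria Ψ) : q ∈ omegaPts Ψ q :=
  (tendsto_const_nhds.congr fun t => (hq t).symm :
    Tendsto (fun t : ℝ => Ψ t q) atTop (𝓝 q)).mapClusterPt

theorem tendsto_self (hq : q ∈ equilibria Ψ) : Tendsto (fun t : ℝ => Ψ t q) atTop (𝓝 q) :=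
  tendsto_const_nhds.congr fun t => (hq t).symm

theorem mem_basin_of_cell_ll (S : MonotoneRepeller C Ψ Γ)
    (hz : z ∈ lowerEdge v (basin C Ψ Γ (some q))) (hzy : LL C z y) (hyq : LL C y q) :
    y ∈ basin C Ψ Γ (some q) := by
  obtain ⟨ε, h1, h2⟩ := (hz.2.and (hzy.eventually_add_smul v)).exists
  exact S.mem_basin_of_between (mem_equilibria_of_mem_cell hz) h1.1 h2.le hyq

theorem mem_basin_none_of_cell_ll (S : MonotoneRepeller C Ψ Γ)
    (hz : z ∈ lowerEdge v (basin C Ψ Γ none)) (hzy : LL C z y) : y ∈ basin C Ψ Γ none := by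
  obtain ⟨ε, h1, h2⟩ := (hz.2.and (hzy.eventually_add_smul v)).exists
  exact S.basin_none_upper h1 h2.le

/-- A basin point strictly above the equilibrium `q` would stay above it, while basin orbits are
eventually strictly below. -/
theorem end_notMem_cell (S : MonotoneRepeller C Ψ Γ) (hv : v ∈ interior (C : Set E)) :
    q ∉ lowerEdge v (basin C Ψ Γ (some q)) := by
  intro h
  have hq := mem_equilibria_of_mem_cell h
  obtain ⟨u, hu, hqu⟩ := exists_ll_of_mem_lowerEdge hv h
  obtain ⟨t, h1, h2⟩ := (hu.2.and (eventually_ge_atTop 0)).exists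
  have h3 := S.mono_ll h2 hqu
  rw [hq t] at h3
  exact S.cone.not_ll_self q (h3.trans h1)

/-- The end of the cell lies above whole orbits in the recurrent part of the cell. -/
theorem flow_le_end_of_mem_cell (S : MonotoneRepeller C Ψ Γ) (hv : v ∈ interior (C : Set E))
    (hL : RecurrentSet Ψ L) (hz : z ∈ L) (hzM : z ∈ lowerEdge v (basin C Ψ Γ (some q))) (s : ℝ) :
    Le C (Ψ s z) q := by
  obtain ⟨y, hy, hzy⟩ := exists_ll_of_mem_lowerEdge hv hzM
  obtain ⟨b, hb, hbu⟩ := S.exists_mem_orbitUpper hL hz hzy (S.basin_some_subset hy)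
  obtain rfl := omegaPts_eq_singleton_of_tendsto hy.1 hb
  simpa [Ψ.map_zero] using hbu 0 s

theorem ll_of_forall_flow_le (S : MonotoneRepeller C Ψ Γ) (hq : q ∈ equilibria Ψ)
    (h : ∀ s : ℝ, Le C (Ψ s z) q) (hne : z ≠ q) : LL C z q := by
  refine S.ll_of_le_neg_one ?_ hne
  rw [hq]
  exact h _

theorem ll_end_of_mem_cell (S : MonotoneRepeller C Ψ Γ) (hv : v ∈ interior (C : Set E))
    (hL : RecurrentSet Ψ L) (hz : z ∈ L) (hzM : z ∈ lowerEdge v (basin C Ψ Γ (some q))) :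
    LL C z q := by
  refine S.ll_of_forall_flow_le (mem_equilibria_of_mem_cell hzM)
    (S.flow_le_end_of_mem_cell hv hL hz hzM) ?_
  rintro rfl
  exact S.end_notMem_cell hv hzM

/-- Points just above a limit `z` lie above cell points, hence in the basin as long as they are
below the end `q`. So only `z ≪ q` matters. It could fail only for `z = q`, but then cell points
would enter an open order interval below `q` that lies inside the basin. -/
theorem isClosed_inter_cell (S : MonotoneRepeller C Ψ Γ) (hv : v ∈ interior (C : Set E))
    (hL : RecurrentSet Ψ L) : IsClosed (L ∩ lowerEdge v (basin C Ψ Γ o)) := by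
  refine isClosed_of_closure_subset fun z hz => ?_
  have hzL : z ∈ L := hL.isClosed.closure_subset_iff.2 inter_subset_left hz
  refine ⟨hzL, S.notMem_basin hL hzL, ?_⟩
  have hbelow : ∀ y, LL C z y → ∃ w ∈ L, w ∈ lowerEdge v (basin C Ψ Γ o) ∧ LL C w y := by
    intro y hy
    obtain ⟨w, hw, hwL, hwM⟩ := mem_closure_iff.1 hz _ (isOpen_ll_left y) hy
    exact ⟨w, hwL, hwM, hw⟩
  rcases o with _ | q
  · filter_upwards [eventually_mem_nhdsWithin] with ε hε
    obtain ⟨w, -, hw, hll⟩ := hbelow _ (ll_add_smul hv hε z)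
    exact S.mem_basin_none_of_cell_ll hw hll
  · have hq : q ∈ equilibria Ψ := by
      obtain ⟨w, -, hw⟩ := closure_nonempty_iff.1 ⟨z, hz⟩
      exact mem_equilibria_of_mem_cell hw
    have hle : ∀ s : ℝ, Le C (Ψ s z) q := fun s =>
      closure_minimal (fun w hw => S.flow_le_end_of_mem_cell hv hL hw.1 hw.2 s)
        ((S.cone.isClosed_le_left q).preimage (continuous_flow s)) hz
    have hne : z ≠ q := by
      rintro rfl
      obtain ⟨w, -, hw⟩ := closure_nonempty_iff.1 ⟨z, hz⟩
      obtain ⟨x, hx⟩ := nonempty_basin_of_nonempty_cell ⟨w, hw⟩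
      obtain ⟨p, hp, s, -, h1, h2, -⟩ := exists_ll_flow hx
      obtain ⟨w', hpw, hwL, hwM⟩ := mem_closure_iff.1 hz _ (isOpen_ll_right p) (h1.trans h2)
      exact hwM.1 (S.mem_basin_of_between hq hp.1 hpw.le (S.ll_end_of_mem_cell hv hL hwL hwM))
    have hzq := S.ll_of_forall_flow_le hq hle hne
    filter_upwards [hzq.eventually_add_smul v, eventually_mem_nhdsWithin] with ε h1 h2
    obtain ⟨w, -, hw, hll⟩ := hbelow _ (ll_add_smul hv h2 z)
    exact S.mem_basin_of_cell_ll hw hll h1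

theorem eventually_notMem_cell (S : MonotoneRepeller C Ψ Γ) (hv : v ∈ interior (C : Set E))
    (hL : RecurrentSet Ψ L) (hz : z ∉ lowerEdge v (basin C Ψ Γ o)) :
    ∀ᶠ w in 𝓝 z, w ∈ L → w ∉ lowerEdge v (basin C Ψ Γ o) := by
  filter_upwards [(S.isClosed_inter_cell (o := o) hv hL).isOpen_compl.mem_nhds fun h => hz h.2]
    with w hw hwL hwM using hw ⟨hwL, hwM⟩

/-- Ends of the other cells met by a recurrent set near `z` are near `z`. -/
theorem eventually_end_mem (S : MonotoneRepeller C Ψ Γ) (hv : v ∈ interior (C : Set E))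
    (hL : RecurrentSet Ψ L) (hzM : z ∈ lowerEdge v (basin C Ψ Γ o))
    {N : Set E} (hN : N ∈ 𝓝 z) :
    ∀ᶠ w in 𝓝 z, w ∈ L → ∀ o', w ∈ lowerEdge v (basin C Ψ Γ o') → o' ≠ o →
      ∃ q ∈ N, o' = some q := by
  obtain ⟨N', hN', hopen, hzN⟩ := mem_nhds_iff.1 hN
  suffices h : ∀ᶠ w in 𝓝 z, w ∈ L → ∀ o', w ∈ lowerEdge v (basin C Ψ Γ o') → o' ≠ o →
      ∃ q ∈ N', o' = some q by
    filter_upwards [h] with w hw h1 o' h2 h3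
    obtain ⟨q, hq, rfl⟩ := hw h1 o' h2 h3
    exact ⟨q, hN' hq, rfl⟩
  by_contra hcon
  rw [not_eventually] at hcon
  have hnone : ∀ᶠ w in 𝓝 z, w ∈ lowerEdge v (basin C Ψ Γ none) → none = o := by
    obtain ⟨y, hy, hzy⟩ := exists_ll_of_mem_lowerEdge hv hzM
    filter_upwards [(isOpen_ll_left y).mem_nhds hzy] with w hwy hw
    exact S.basin_disjoint (S.mem_basin_none_of_cell_ll hw hwy) hy
  have hfreq : ∃ᶠ w in 𝓝 z, ∃ q, w ∈ L ∧ w ∈ lowerEdge v (basin C Ψ Γ (some q)) ∧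
      some q ≠ o ∧ q ∉ N' := by
    refine (hcon.and_eventually hnone).mono fun w hw => ?_
    obtain ⟨h1, h2⟩ := hw
    push Not at h1
    obtain ⟨hwL, o', hwM, hne, hno⟩ := h1
    rcases o' with _ | q
    · exact (hne (h2 hwM)).elim
    · exact ⟨q, hwL, hwM, hne, fun h => hno q h rfl⟩
  obtain ⟨U, hev, hU⟩ := mem_closure_iff_ultrafilter.1 (mem_closure_iff_frequently.2 hfreq)
  have hev : ∀ᶠ w in (U : Filter E), ∃ q, w ∈ L ∧ w ∈ lowerEdge v (basin C Ψ Γ (some q)) ∧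
      some q ≠ o ∧ q ∉ N' := hev
  choose! p hp using fun w (h : ∃ q, w ∈ L ∧ w ∈ lowerEdge v (basin C Ψ Γ (some q)) ∧
      some q ≠ o ∧ q ∉ N') => h
  obtain ⟨q, -, hlim⟩ := S.compact.ultrafilter_le_nhds (U.map p) (tendsto_principal.2
    (hev.mono fun w hw => S.mem_of_mem_equilibria (mem_equilibria_of_mem_cell (hp w hw).2.1)))
  have hlim : Tendsto p U (𝓝 q) := hlim
  have hid : Tendsto id (U : Filter E) (𝓝 z) := hU
  have hqN : q ∉ N' := hopen.isClosed_compl.mem_of_tendsto hlim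
    (hev.mono fun w hw => (hp w hw).2.2.2)
  have hqE : q ∈ equilibria Ψ := isClosed_equilibria.mem_of_tendsto hlim
    (hev.mono fun w hw => mem_equilibria_of_mem_cell (hp w hw).2.1)
  have hle : ∀ s : ℝ, Le C (Ψ s z) q := fun s =>
    S.cone.le_of_tendsto (((continuous_flow s).tendsto z).comp hid) hlim
      (hev.mono fun w hw => S.flow_le_end_of_mem_cell hv hL (hp w hw).1 (hp w hw).2.1 s).frequently
  -- The ends `p w` converge to a `q` away from `z`, so `z ≪ q`. A point `z + ε • v` then lies in
  -- the basin of `o` and, between `w` and `p w`, also in the basin of `p w`; basins are disjoint.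
  have hzq : LL C z q := S.ll_of_forall_flow_le hqE hle fun h => hqN (h ▸ hzN)
  obtain ⟨ε, ⟨h1, h2⟩, h3⟩ := ((hzM.2.and (hzq.eventually_add_smul v)).and
    eventually_mem_nhdsWithin).exists
  obtain ⟨w, ⟨hw, hwy⟩, hyp⟩ := ((hev.and (hU ((isOpen_ll_left _).mem_nhds
    (ll_add_smul hv h3 z)))).and (h2.eventually tendsto_const_nhds hlim)).exists
  obtain ⟨-, hwM, hne, -⟩ := hp w hw
  exact hne (S.basin_disjoint (S.mem_basin_of_cell_ll hwM hwy hyp) h1)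

/-- A point of a recurrent set below a compact invariant set is far below or a minimum. -/
theorem forall_ll_of_forall_le (S : MonotoneRepeller C Ψ Γ) (hL : RecurrentSet Ψ L) {K : Set E}
    (hK : IsCompact K) (hinv : ∀ (t : ℝ), ∀ k ∈ K, Ψ t k ∈ K) (hu : u ∈ L)
    (hle : ∀ k ∈ K, Le C u k) (hne : u ∉ K) : ∀ k ∈ K, LL C u k := by
  have hopen : IsOpen {w | ∀ k ∈ K, LL C w k} :=
    isOpen_iff_mem_nhds.2 fun w hw => eventually_forall_ll_of_isCompact hK hw
  have hfwd : ∀ t : ℝ, 0 ≤ t → ∀ w ∈ {w | ∀ k ∈ K, LL C w k}, Ψ t w ∈ {w | ∀ k ∈ K, LL C w k} := by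
    intro t ht w hw k hk
    have := S.mono_ll ht (hw _ (hinv (-t) k hk))
    rwa [flow_flow_neg] at this
  -- This is `Ψ 1 u`, seen from time `-1`: the closure statement then holds at `Ψ (-1) u`, and the
  -- remaining time unit turns `≤` into `≪` at `u`.
  have h1 : Ψ 2 (Ψ (-1) u) ∈ {w | ∀ k ∈ K, LL C w k} := by
    intro k hk
    have := S.ll_of_le_of_ne one_pos (hle _ (hinv (-1) k hk)) fun h => hne (h ▸ hinv _ k hk)
    rw [flow_flow_neg] at this
    rw [← Ψ.map_add]
    norm_num
    exact this
  have h2 := hL.mem_closure_of_flow_mem hopen hfwd (hL.inv (-1) u hu) h1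
  intro k hk
  refine S.ll_of_le_neg_one ?_ fun h => hne (h ▸ hk)
  exact closure_minimal (fun w hw => (hw _ (hinv (-1) k hk)).le) (S.cone.isClosed_le_left _) h2

theorem ll_of_le_equilibrium (S : MonotoneRepeller C Ψ Γ) (hL : RecurrentSet Ψ L)
    (he : e ∈ equilibria Ψ) (hu : u ∈ L) (hle : Le C u e) (hne : u ≠ e) : LL C u e :=
  S.forall_ll_of_forall_le hL isCompact_singleton
    (by rintro t k rfl; exact he t) hu (by rintro k rfl; exact hle) hne e rfl

theorem ll_of_equilibrium_le (S : MonotoneRepeller C Ψ Γ) (hL : RecurrentSet Ψ L)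
    (he : e ∈ equilibria Ψ) (hu : u ∈ L) (hle : Le C e u) (hne : u ≠ e) : LL C e u := by
  have hfwd : ∀ t : ℝ, 0 ≤ t → ∀ w ∈ {w | LL C e w}, Ψ t w ∈ {w | LL C e w} := by
    intro t ht w hw
    have := S.mono_ll ht hw
    rwa [he t] at this
  have h1 : Ψ 2 (Ψ (-1) u) ∈ {w | LL C e w} := by
    have := S.ll_of_le_of_ne one_pos hle hne.symm
    rw [he 1] at this
    rw [← Ψ.map_add]
    norm_num
    exact this
  have h2 := hL.mem_closure_of_flow_mem (isOpen_ll_right e) hfwd (hL.inv (-1) u hu) h1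
  refine S.ll_of_le_neg_one ?_ hne.symm
  rw [he]
  exact closure_minimal (fun w hw => hw.le) (S.cone.isClosed_le_right e) h2

theorem ll_or_ll_of_not_unrelated (S : MonotoneRepeller C Ψ Γ) (hL : RecurrentSet Ψ L)
    (he : e ∈ equilibria Ψ) (hu : u ∈ L) (h : ¬ Unrelated C e u) (hne : u ≠ e) :
    LL C e u ∨ LL C u e := by
  by_cases h1 : Le C e u
  · exact Or.inl (S.ll_of_equilibrium_le hL he hu h1 hne)
  · have h2 : Le C u e := by
      by_contra h2
      exact h ⟨h1, h2⟩
    exact Or.inr (S.ll_of_le_equilibrium hL he hu h2 hne)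

theorem not_unrelated_self (S : MonotoneRepeller C Ψ Γ) : ¬ Unrelated C e e :=
  fun h => h.1 (S.cone.le_refl e)

theorem eventually_unrelated (S : MonotoneRepeller C Ψ Γ) (h : Unrelated C e u) :
    ∀ᶠ w in 𝓝 u, Unrelated C e w := by
  filter_upwards [(S.cone.isClosed_le_right e).isOpen_compl.mem_nhds h.1,
    (S.cone.isClosed_le_left e).isOpen_compl.mem_nhds h.2] with w h1 h2 using ⟨h1, h2⟩

theorem eventually_not_unrelated (S : MonotoneRepeller C Ψ Γ) (hL : RecurrentSet Ψ L)
    (he : e ∈ equilibria Ψ) (hu : u ∈ L) (h : ¬ Unrelated C e u) (hne : u ≠ e) :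
    ∀ᶠ w in 𝓝 u, ¬ Unrelated C e w := by
  rcases S.ll_or_ll_of_not_unrelated hL he hu h hne with h1 | h1
  · filter_upwards [(isOpen_ll_right e).mem_nhds h1] with w hw h2 using h2.1 hw.le
  · filter_upwards [(isOpen_ll_left e).mem_nhds h1] with w hw h2 using h2.2 hw.le

/-- In a connected recurrent set, no point is unrelated to both of two ordered equilibria. -/
theorem not_unrelated_both (S : MonotoneRepeller C Ψ Γ) (hL : RecurrentSet Ψ L)
    (hB : IsPreconnected B) (hBL : B ⊆ L) (he : e ∈ equilibria Ψ) (he' : e' ∈ equilibria Ψ)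
    (hll : LL C e e') (hmem : e ∈ B ∨ e' ∈ B) (hu : u ∈ B) :
    ¬ (Unrelated C e u ∧ Unrelated C e' u) := by
  refine subset_of_isPreconnected_of_eventually (A := {u | ¬ (Unrelated C e u ∧ Unrelated C e' u)})
    hB ?_ ?_ ?_ hu
  · rcases hmem with h | h
    · exact ⟨e, h, fun h => S.not_unrelated_self h.1⟩
    · exact ⟨e', h, fun h => S.not_unrelated_self h.2⟩
  · intro x hxB hx
    by_cases h1 : Unrelated C e x
    · have h2 : ¬ Unrelated C e' x := fun h2 => hx ⟨h1, h2⟩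
      by_cases hxe : x = e'
      · exact (h1.1 (hxe ▸ hll.le)).elim
      · filter_upwards [S.eventually_not_unrelated hL he' (hBL hxB) h2 hxe] with w hw _ h
        exact hw h.2
    · by_cases hxe : x = e
      · filter_upwards [(isOpen_ll_left e').mem_nhds (hxe ▸ hll : LL C x e')] with w hw _ h
        exact h.2.2 hw.le
      · filter_upwards [S.eventually_not_unrelated hL he (hBL hxB) h1 hxe] with w hw _ h
        exact hw h.1
  · intro x hxB hx
    have hx : Unrelated C e x ∧ Unrelated C e' x := not_not.1 hx
    filter_upwards [S.eventually_unrelated hx.1, S.eventually_unrelated hx.2] with w h1 h2 _ h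
    exact h ⟨h1, h2⟩

/-- An equilibrium separates a point of a recurrent set from the omega limit set of a point far
above it. -/
theorem exists_equilibrium_between (S : MonotoneRepeller C Ψ Γ) (hv : v ∈ interior (C : Set E))
    (hL : RecurrentSet Ψ L) (hu : u ∈ L) (hy : y ∈ Γ) (huy : LL C u y) :
    ∃ p ∈ equilibria Ψ, Le C u p ∧ ∀ b ∈ omegaPts Ψ y, Le C p b := by
  rcases S.mem_cell_or_softAbove hv hL hu with ⟨o, ho⟩ | ⟨hE, -⟩
  · obtain ⟨ε, h1, h2⟩ := (ho.2.and (huy.eventually_add_smul v)).exists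
    rcases o with _ | q
    · exact (S.notMem_basin_none hy (S.basin_none_upper h1 h2.le)).elim
    · exact ⟨q, mem_equilibria_of_mem_cell ho, (S.ll_end_of_mem_cell hv hL hu ho).le,
        fun b hb => S.le_of_tendsto_of_mem_omegaPts h1.1 hb h2.le⟩
  · exact ⟨u, hE, S.cone.le_refl u,
      fun b hb => S.le_of_tendsto_of_mem_omegaPts (tendsto_self hE) hb huy.le⟩

theorem mem_equilibria_of_forall_le (S : MonotoneRepeller C Ψ Γ) {K : Set E}
    (hinv : ∀ (t : ℝ), ∀ k ∈ K, Ψ t k ∈ K) {m : E} (hm : m ∈ K) (hle : ∀ k ∈ K, Le C m k) :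
    m ∈ equilibria Ψ := by
  have key : ∀ t : ℝ, 0 ≤ t → Ψ t m = m := by
    intro t ht
    have h1 := S.mono_le ht (hle _ (hinv (-t) m hm))
    rw [flow_flow_neg] at h1
    exact S.cone.le_antisymm h1 (hle _ (hinv t m hm))
  intro t
  rcases le_total 0 t with ht | ht
  · exact key t ht
  · have := congrArg (Ψ t) (key (-t) (neg_nonneg.2 ht))
    rw [flow_flow_neg] at this
    exact this.symm

/-- If `u` is unrelated to `e`, connectedness makes points of `B` unrelated to `e` accumulate at
`e`. This keeps `e` out of the omega limit sets `K` of the points above it, so `e` is strictly below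
`K`. Connectedness then gives `u ≤ K`, and as these `K` come arbitrarily close to `e`, `u ≤ e`
follows. -/
theorem not_unrelated_of_softAbove (S : MonotoneRepeller C Ψ Γ) (hv : v ∈ interior (C : Set E))
    (hL : RecurrentSet Ψ L) (hB : IsPreconnected B) (hBL : B ⊆ L) (heB : e ∈ B)
    (he : e ∈ equilibria Ψ) (hsoft : SoftAbove Ψ Γ v e) (hu : u ∈ B) : ¬ Unrelated C e u := by
  intro hun
  have hfreq : ∃ᶠ w in 𝓝 e, w ∈ B ∧ Unrelated C e w := by
    by_contra hcon
    rw [not_frequently] at hcon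
    refine subset_of_isPreconnected_of_eventually (A := {w | ¬ Unrelated C e w}) hB
      ⟨e, heB, S.not_unrelated_self⟩ ?_ ?_ hu hun
    · intro x hxB hx
      by_cases hxe : x = e
      · rw [hxe]
        filter_upwards [hcon] with w hw hwB h using hw ⟨hwB, h⟩
      · filter_upwards [S.eventually_not_unrelated hL he (hBL hxB) hx hxe] with w hw _ using hw
    · intro x _ hx
      filter_upwards [S.eventually_unrelated (not_not.1 hx)] with w hw _ using not_not.2 hw
  have hnot : ∀ ε : ℝ, 0 < ε → e + ε • v ∈ Γ → e ∉ omegaPts Ψ (e + ε • v) := by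
    intro ε hε hΓ hmem
    obtain ⟨w, ⟨hwB, hw⟩, hwy⟩ := (hfreq.and_eventually (eventually_ll_add_smul hv hε e)).exists
    obtain ⟨p, -, h1, h2⟩ := S.exists_equilibrium_between hv hL (hBL hwB) hΓ hwy
    exact hw.2 (h1.trans (h2 e hmem))
  have hle : ∀ ε : ℝ, 0 < ε → e + ε • v ∈ Γ → ∀ b ∈ omegaPts Ψ (e + ε • v), Le C u b := by
    intro ε hε hΓ
    set K := omegaPts Ψ (e + ε • v) with hKdef
    have hK : IsCompact K := S.isCompact_omegaPts hΓ
    have hinv : ∀ (t : ℝ), ∀ k ∈ K, Ψ t k ∈ K := fun t k hk => flow_mem_omegaPts t hk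
    have heK : ∀ k ∈ K, Le C e k := fun k hk =>
      S.le_of_tendsto_of_mem_omegaPts (tendsto_self he) hk (ll_add_smul hv hε e).le
    have heK' := S.forall_ll_of_forall_le hL hK hinv (hBL heB) heK (hnot ε hε hΓ)
    -- A minimum of `K` in `B` is an equilibrium above `e`, so `u` must be related to it. Without
    -- one, the points of `B` strictly below `K` form a relatively clopen set containing `e`.
    by_cases hmin : ∃ m ∈ K, m ∈ B ∧ ∀ k ∈ K, Le C m k
    · obtain ⟨m, hmK, hmB, hm⟩ := hmin
      have hmE := S.mem_equilibria_of_forall_le hinv hmK hm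
      have h1 : ¬ Unrelated C m u := fun h =>
        S.not_unrelated_both hL hB hBL he hmE (heK' m hmK) (Or.inl heB) hu ⟨hun, h⟩
      have h2 : Le C u m := by
        by_contra h2
        exact h1 ⟨fun h3 => hun.1 ((heK' m hmK).le.trans h3), h2⟩
      exact fun b hb => h2.trans (hm b hb)
    · push Not at hmin
      have hsub : B ⊆ {w | ∀ k ∈ K, LL C w k} := by
        refine subset_of_isPreconnected_of_eventually hB ⟨e, heB, heK'⟩ ?_ ?_
        · intro x _ hx
          filter_upwards [eventually_forall_ll_of_isCompact hK hx] with w hw _ using hw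
        · intro x hxB hx
          by_contra hcon
          rw [not_eventually] at hcon
          have hxle : ∀ k ∈ K, Le C x k := fun k hk =>
            S.cone.le_of_tendsto tendsto_id tendsto_const_nhds (hcon.mono fun w hw => by
              push Not at hw
              exact (hw.2 k hk).le)
          refine hx (S.forall_ll_of_forall_le hL hK hinv (hBL hxB) hxle fun hxK => ?_)
          obtain ⟨k, hk, hkx⟩ := hmin x hxK hxB
          exact hkx (hxle k hk)
      exact fun b hb => (hsub hu b hb).le
  refine hun.2 ?_
  have : e ∈ closure {b | Le C u b} := by
    rw [mem_closure_iff_nhds]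
    intro N hN
    obtain ⟨ε, hε, hΓ, b, hbN, hb⟩ := hsoft N hN
    exact ⟨b, hbN, hle ε hε hΓ b hb⟩
  exact (S.cone.isClosed_le_right u).closure_subset this

theorem eventually_not_ll_of_mem_cell (S : MonotoneRepeller C Ψ Γ)
    (hv : v ∈ interior (C : Set E)) (hL : RecurrentSet Ψ L)
    (hz : z ∈ lowerEdge v (basin C Ψ Γ o)) : ∀ᶠ w in 𝓝 z, w ∈ L → ¬ LL C z w := by
  obtain ⟨y, hy, hzy⟩ := exists_ll_of_mem_lowerEdge hv hz
  filter_upwards [(isOpen_ll_left y).mem_nhds hzy] with w hwy hw hzw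
  exact S.notMem_basin hL hw (mem_of_lowerEdge_ll S.llConvex_basin hz hzw hy hwy)

/-- Nearby points of `B` outside the cell are equilibria, or lie in other cells whose ends are
equilibria close to `z`; the set of equilibria is closed. -/
theorem mem_equilibria_of_boundary (S : MonotoneRepeller C Ψ Γ) (hv : v ∈ interior (C : Set E))
    (hL : RecurrentSet Ψ L) (hBL : B ⊆ L) (hz : z ∈ lowerEdge v (basin C Ψ Γ o))
    (hfreq : ∃ᶠ w in 𝓝 z, w ∈ B ∧ w ∉ lowerEdge v (basin C Ψ Γ o)) : z ∈ equilibria Ψ := by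
  refine isClosed_equilibria.closure_subset (mem_closure_iff_nhds.2 fun N hN => ?_)
  obtain ⟨w, ⟨⟨hwB, hw⟩, hwN⟩, h1⟩ := ((hfreq.and_eventually hN).and_eventually
    (S.eventually_end_mem hv hL hz hN)).exists
  rcases S.mem_cell_or_softAbove hv hL (hBL hwB) with ⟨o', ho'⟩ | ⟨hE, -⟩
  · obtain ⟨q, hqN, rfl⟩ := h1 (hBL hwB) o' ho' fun h => hw (h ▸ ho')
    exact ⟨q, hqN, mem_equilibria_of_mem_cell ho'⟩
  · exact ⟨w, hwN, hE⟩

theorem exists_boundary (S : MonotoneRepeller C Ψ Γ) (hv : v ∈ interior (C : Set E))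
    (hL : RecurrentSet Ψ L) (hB : IsPreconnected B) (hBL : B ⊆ L) (hxB : x ∈ B)
    (hx : x ∈ lowerEdge v (basin C Ψ Γ o)) (hno : ¬ B ⊆ lowerEdge v (basin C Ψ Γ o)) :
    ∃ z ∈ B, z ∈ lowerEdge v (basin C Ψ Γ o) ∧
      ∃ᶠ w in 𝓝 z, w ∈ B ∧ w ∉ lowerEdge v (basin C Ψ Γ o) := by
  by_contra! hcon
  refine hno (subset_of_isPreconnected_of_eventually hB ⟨x, hxB, hx⟩ ?_ ?_)
  · intro z hzB hz
    exact hcon z hzB hz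
  · intro z _ hz
    filter_upwards [S.eventually_notMem_cell hv hL hz] with w hw hwB using hw (hBL hwB)

/-- If `u` is unrelated to `z`, it suffices to find points below `u` arbitrarily near `z`, since
then `z ≤ u`. A nearby point `w` of `B` outside the cell supplies one: `w` itself if it is a soft
equilibrium, otherwise the end `q` of its cell. -/
theorem not_unrelated_of_boundary (S : MonotoneRepeller C Ψ Γ) (hv : v ∈ interior (C : Set E))
    (hL : RecurrentSet Ψ L) (hB : IsPreconnected B) (hBL : B ⊆ L) (hzB : z ∈ B)
    (hz : z ∈ lowerEdge v (basin C Ψ Γ o))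
    (hfreq : ∃ᶠ w in 𝓝 z, w ∈ B ∧ w ∉ lowerEdge v (basin C Ψ Γ o)) (hu : u ∈ B) :
    ¬ Unrelated C z u := by
  intro hun
  have hzE := S.mem_equilibria_of_boundary hv hL hBL hz hfreq
  refine hun.1 ((S.cone.isClosed_le_left u).closure_subset (mem_closure_iff_nhds.2 fun N hN => ?_))
  -- Keeps the nearby ends strictly below the end of the cell of `z`; this excludes `z ≤ q` below.
  have hN' : {c | ∀ q, o = some q → LL C c q} ∈ 𝓝 z := by
    rcases o with _ | q
    · simp
    · filter_upwards [(isOpen_ll_left q).mem_nhds (S.ll_end_of_mem_cell hv hL (hBL hzB) hz)]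
        with c hc q' hq'
      rwa [← Option.some_injective _ hq']
  obtain ⟨w, ⟨⟨⟨⟨hwB, hwM⟩, hwN⟩, hend⟩, hnll⟩, hself⟩ :=
    ((((hfreq.and_eventually hN).and_eventually
      (S.eventually_end_mem hv hL hz (inter_mem hN hN'))).and_eventually
      (S.eventually_not_ll_of_mem_cell hv hL hz)).and_eventually
      (S.eventually_notMem_cell (o := some z) hv hL (S.end_notMem_cell hv))).exists
  have hwL := hBL hwB
  have hwz : w ≠ z := fun h => hwM (h ▸ hz)
  have hll : ¬ Unrelated C z w → LL C w z := fun h =>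
    (S.ll_or_ll_of_not_unrelated hL hzE hwL h hwz).resolve_left (hnll hwL)
  rcases S.mem_cell_or_softAbove hv hL hwL with ⟨o', ho'⟩ | ⟨hwE, hsoft⟩
  · have hne : o' ≠ o := fun h => hwM (h ▸ ho')
    obtain ⟨q, ⟨hqN, hqo⟩, rfl⟩ := hend hwL o' ho' hne
    have hqE := mem_equilibria_of_mem_cell ho'
    have hwq := S.ll_end_of_mem_cell hv hL hwL ho'
    have hqz : q ≠ z := by
      rintro rfl
      exact hself hwL ho'
    have hzq : ¬ Le C z q := by
      intro h
      have h1 := S.ll_of_equilibria hzE hqE h hqz.symm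
      obtain ⟨ε, h2, h3⟩ := (hz.2.and (h1.eventually_add_smul v)).exists
      rcases o with _ | q'
      · exact S.notMem_basin_none (S.mem_of_mem_equilibria hqE) (S.basin_none_upper h2 h3.le)
      · exact (hqo q' rfl).not_le S.cone
          (S.le_of_tendsto_of_mem_omegaPts h2.1 (mem_omegaPts_self hqE) h3.le)
    by_cases hqz' : Le C q z
    · have hqllz := S.ll_of_equilibria hqE hzE hqz' hqz
      have h1 : ¬ Unrelated C q u := fun h =>
        S.not_unrelated_both hL hB hBL hqE hzE hqllz (Or.inr hzB) hu ⟨h, hun⟩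
      refine ⟨q, hqN, ?_⟩
      by_contra h2
      exact h1 ⟨h2, fun h3 => hun.2 (h3.trans hqz')⟩
    · exfalso
      -- With `q` unrelated to `z`, the set `B` also leaves the cell of `q`, at an equilibrium `z'`.
      -- Then `z' ≪ z` and so `w ≪ z`, which places basin points of `q` below `z` and gives `q ≤ z`.
      have hno : ¬ B ⊆ lowerEdge v (basin C Ψ Γ (some q)) := fun h =>
        hne (S.cell_disjoint (h hzB) hz)
      obtain ⟨z', hz'B, hz', hfreq'⟩ := S.exists_boundary hv hL hB hBL hwB ho' hno
      have hz'E := S.mem_equilibria_of_boundary hv hL hBL hz' hfreq'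
      have hz'q := S.ll_end_of_mem_cell hv hL (hBL hz'B) hz'
      have h1 : ¬ Unrelated C z' z := fun h =>
        S.not_unrelated_both hL hB hBL hz'E hqE hz'q (Or.inl hz'B) hzB ⟨h, hqz', hzq⟩
      have hz'z : Le C z' z := by
        by_contra h2
        exact h1 ⟨h2, fun h3 => hzq (h3.trans hz'q.le)⟩
      have hz'ne : z' ≠ z := by
        rintro rfl
        exact hne (S.cell_disjoint hz' hz)
      have hz'll := S.ll_of_equilibria hz'E hzE hz'z hz'ne
      have hwllz : LL C w z := by
        by_cases h2 : Unrelated C z' w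
        · exact hll fun h =>
            S.not_unrelated_both hL hB hBL hz'E hzE hz'll (Or.inl hz'B) hwB ⟨h2, h⟩
        · have : z' = w := by
            by_cases h3 : Le C z' w
            · exact S.cell_unordered hv _ hz' _ ho' h3
            · by_contra hne'
              refine h2 ⟨h3, fun h4 => hne' ?_⟩
              exact (S.cell_unordered hv _ ho' _ hz' h4).symm
          rwa [← this]
      obtain ⟨ε, h2, h3⟩ := (ho'.2.and (hwllz.eventually_add_smul v)).exists
      exact hqz' (S.le_of_tendsto_of_mem_omegaPts h2.1 (mem_omegaPts_self hzE) h3.le)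
  · have h1 := fun u (hu : u ∈ B) =>
      S.not_unrelated_of_softAbove hv hL hB hBL hwB hwE hsoft hu
    have hwllz : LL C w z := hll fun h => h1 z hzB ⟨h.2, h.1⟩
    refine ⟨w, hwN, ?_⟩
    by_contra h2
    exact h1 u hu ⟨h2, fun h3 => hun.2 (h3.trans hwllz.le)⟩

/-- Dichotomy for the connected subsets of a recurrent set. -/
theorem equilibria_stronglyOrdered_or_subset_cell (S : MonotoneRepeller C Ψ Γ)
    (hv : v ∈ interior (C : Set E)) (hL : RecurrentSet Ψ L) (hB : IsPreconnected B)
    (hBL : B ⊆ L) : (B ⊆ equilibria Ψ ∧ StronglyOrdered C B) ∨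
      ∃ o, B ⊆ lowerEdge v (basin C Ψ Γ o) := by
  by_cases hcell : ∃ o, B ⊆ lowerEdge v (basin C Ψ Γ o)
  · exact Or.inr hcell
  push Not at hcell
  have key : ∀ x ∈ B, x ∈ equilibria Ψ ∧ ∀ u ∈ B, ¬ Unrelated C x u := by
    intro x hxB
    rcases S.mem_cell_or_softAbove hv hL (hBL hxB) with ⟨o, ho⟩ | ⟨hE, hsoft⟩
    · obtain ⟨z, hzB, hz, hfreq⟩ := S.exists_boundary hv hL hB hBL hxB ho (hcell o)
      have h1 := fun u (hu : u ∈ B) =>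
        S.not_unrelated_of_boundary hv hL hB hBL hzB hz hfreq hu
      have hzx : z = x := by
        by_contra hne
        exact h1 x hxB ⟨fun h => hne (S.cell_unordered hv _ hz _ ho h),
          fun h => hne (S.cell_unordered hv _ ho _ hz h).symm⟩
      subst hzx
      exact ⟨S.mem_equilibria_of_boundary hv hL hBL hz hfreq, h1⟩
    · exact ⟨hE, fun u hu => S.not_unrelated_of_softAbove hv hL hB hBL hxB hE hsoft hu⟩
  exact Or.inl ⟨fun x hx => (key x hx).1, fun x hx y hy hne =>
    S.ll_or_ll_of_not_unrelated hL (key x hx).1 (hBL hy) ((key x hx).2 y hy) hne.symm⟩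

end MonotoneRepeller

/-! ### Back to the competitive flow and its invariant measures -/

theorem equilibria_reverse (Φ : Flow ℝ E) : equilibria Φ.reverse = equilibria Φ := by
  ext p
  constructor
  · intro h t
    have := h (-t)
    rwa [Flow.reverse_apply, neg_neg] at this
  · intro h t
    exact h (-t)

theorem monotoneRepeller_reverse [FiniteDimensional ℝ E] {C : ConvexCone ℝ E}
    (hC : IsSolidCone C) {Φ : Flow ℝ E} (hΦ : StronglyCompetitive C Φ) {Γ : Set E}
    (hΓ : IsDissipativeAttractor Φ Γ) : MonotoneRepeller C Φ.reverse Γ where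
  cone := hC
  mono x y t ht h := by
    refine hΦ _ _ t ht ?_
    rwa [Flow.reverse_apply, Flow.reverse_apply, flow_flow_neg, flow_flow_neg]
  nonempty := hΓ.isAttractor.nonempty
  compact := hΓ.isAttractor.isCompact
  inv t x hx := by
    rw [← hΓ.isAttractor.invariant (-t)]
    exact mem_image_of_mem _ hx
  escape x hx := by
    have : ProperSpace E := FiniteDimensional.proper_real E
    have hpos : 0 < Metric.infDist x Γ :=
      (hΓ.isAttractor.isCompact.isClosed.notMem_iff_infDist_pos hΓ.isAttractor.nonempty).1 hx
    -- If `Φ (-t) x` stayed in the ball of radius `K` at a large time, uniform attraction of that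
    -- ball would bring `x = Φ t (Φ (-t) x)` closer to `Γ` than it is.
    refine tendsto_atTop.2 fun K => ?_
    obtain ⟨T, hT⟩ := hΓ.attracts_compact _ (isCompact_closedBall (0 : E) K) _ hpos
    filter_upwards [eventually_ge_atTop T] with t ht
    by_contra! h
    have := hT t ht (Φ (-t) x) (mem_closedBall_zero_iff.2 h.le)
    rw [flow_flow_neg] at this
    exact lt_irrefl _ this

theorem recurrentSet_support [FiniteDimensional ℝ E] [MeasurableSpace E] [BorelSpace E]
    {Φ : Flow ℝ E} {μ : Measure E} [IsProbabilityMeasure μ]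
    (hμ : ∀ t : ℝ, 0 ≤ t → MeasurePreserving (Φ t) μ μ) : RecurrentSet Φ.reverse μ.support := by
  have : ProperSpace E := FiniteDimensional.proper_real E
  have hneg : ∀ t : ℝ, 0 ≤ t → MeasurePreserving (Φ (-t)) μ μ := by
    intro t ht
    have h : MeasurePreserving (Φ.toHomeomorph t).toMeasurableEquiv μ μ := hμ t ht
    exact h.symm
  have hall : ∀ t : ℝ, MeasurePreserving (Φ.reverse t) μ μ := by
    intro t
    rcases le_total 0 t with ht | ht
    · exact hneg t ht
    · exact hμ (-t) (neg_nonneg.2 ht)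
  refine ⟨Measure.isClosed_support, fun t x hx => ?_, fun x hx => ?_⟩
  · rw [Measure.mem_support_iff_forall] at hx ⊢
    intro U hU
    obtain ⟨V, hVU, hV, hxV⟩ := mem_nhds_iff.1 hU
    have h1 := hx _ ((hV.preimage (continuous_flow t)).mem_nhds hxV)
    rw [(hall t).measure_preimage hV.measurableSet.nullMeasurableSet] at h1
    exact h1.trans_le (measure_mono hVU)
  · have hrec : ∀ᵐ y ∂μ, Recurrent Φ.reverse y := by
      filter_upwards [(hall 1).conservative.ae_frequently_mem_of_mem_nhds] with y hy
      have hiter : ∀ n : ℕ, (Φ.reverse 1)^[n] y = Φ.reverse (n : ℝ) y := by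
        intro n
        induction n with
        | zero => rw [Nat.cast_zero, Flow.map_zero_apply, Function.iterate_zero_apply]
        | succ n ih =>
          rw [Function.iterate_succ_apply', ih, ← Flow.map_add]
          congr 1
          push_cast
          ring
      refine mapClusterPt_iff_frequently.2 fun s hs => ?_
      refine tendsto_natCast_atTop_atTop.frequently ((hy s hs).mono fun n hn => ?_)
      rwa [hiter] at hn
    rw [mem_closure_iff_nhds]
    intro U hU
    by_contra hempty
    have hzero : μ U = 0 := by
      refine measure_mono_null (fun y hy => ?_) (ae_iff.1 hrec)
      exact fun h => hempty ⟨y, hy, h⟩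
    exact ((Measure.mem_support_iff_forall x).1 hx U hU).ne' hzero

/-- The requirement that `q` be an equilibrium can be dropped: a nonempty edge has a nonempty basin,
and a limit of an orbit is an equilibrium. -/
theorem mem_cellFamily_iff [FiniteDimensional ℝ E] [Nontrivial E] {C : ConvexCone ℝ E}
    {Φ : Flow ℝ E} {Γ : Set E} (S : MonotoneRepeller C Φ.reverse Γ) {v : E}
    (hv : v ∈ interior (C : Set E)) {M : Set E} : M ∈ cellFamily C Φ Γ ↔
      M.Nonempty ∧ ∃ o, M = lowerEdge v (basin C Φ.reverse Γ o) := by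
  have hlb : ∀ o, lowerBoundary C (basin C Φ.reverse Γ o) =
      lowerEdge v (basin C Φ.reverse Γ o) := fun o =>
    lowerBoundary_eq_lowerEdge hv S.isOpen_basin S.llConvex_basin
  constructor
  · rintro ⟨hne, rfl | ⟨q, -, rfl⟩⟩
    · exact ⟨hne, none, hlb none⟩
    · exact ⟨hne, some q, hlb (some q)⟩
  · rintro ⟨⟨z, hz⟩, o, rfl⟩
    refine ⟨⟨z, hz⟩, ?_⟩
    rcases o with _ | q
    · exact Or.inl (hlb none).symm
    · refine Or.inr ⟨q, ?_, (hlb (some q)).symm⟩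
      rw [← equilibria_reverse]
      exact MonotoneRepeller.mem_equilibria_of_mem_cell hz

end CompetitiveFlow

open CompetitiveFlow in
theorem theorem2p2 (n : ℕ) (hn : 1 ≤ n)
    (C : ConvexCone ℝ (EuclideanSpace ℝ (Fin n))) (hC : CompetitiveFlow.IsSolidCone C)
    (Φ : Flow ℝ (EuclideanSpace ℝ (Fin n)))
    (hΦ : CompetitiveFlow.StronglyCompetitive C Φ)
    (Γ : Set (EuclideanSpace ℝ (Fin n)))
    (hΓ : CompetitiveFlow.IsDissipativeAttractor Φ Γ) :
    -- the family is a countable disjoint family of invariant unordered open cells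
    ((CompetitiveFlow.cellFamily C Φ Γ).Countable ∧
      (CompetitiveFlow.cellFamily C Φ Γ).PairwiseDisjoint id ∧
      ∀ M ∈ CompetitiveFlow.cellFamily C Φ Γ,
        CompetitiveFlow.Invariant Φ M ∧ CompetitiveFlow.Unordered C M ∧
          CompetitiveFlow.IsOpenCell (n - 1) M) ∧
    -- the dichotomy for the components of the support of an invariant measure
    ∀ (μ : Measure (EuclideanSpace ℝ (Fin n))) [IsProbabilityMeasure μ],
      (∀ t : ℝ, 0 ≤ t → MeasurePreserving (Φ t) μ μ) →
      ∀ x ∈ μ.support,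
        (connectedComponentIn μ.support x ⊆ CompetitiveFlow.equilibria Φ ∧
          CompetitiveFlow.StronglyOrdered C (connectedComponentIn μ.support x)) ∨
        ∃ M ∈ CompetitiveFlow.cellFamily C Φ Γ, connectedComponentIn μ.support x ⊆ M := by
  have : Nonempty (Fin n) := ⟨⟨0, hn⟩⟩
  obtain ⟨v, hv⟩ := hC.solid
  have S := monotoneRepeller_reverse hC hΦ hΓ
  refine ⟨⟨?_, ?_, ?_⟩, ?_⟩
  · refine (S.countable_basin_nonempty.image
      fun o => lowerEdge v (basin C Φ.reverse Γ o)).mono fun M hM => ?_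
    obtain ⟨hne, o, rfl⟩ := (mem_cellFamily_iff S hv).1 hM
    exact ⟨o, MonotoneRepeller.nonempty_basin_of_nonempty_cell hne, rfl⟩
  · intro M hM M' hM' hne
    obtain ⟨-, o, rfl⟩ := (mem_cellFamily_iff S hv).1 hM
    obtain ⟨-, o', rfl⟩ := (mem_cellFamily_iff S hv).1 hM'
    exact Set.disjoint_left.2 fun z hz hz' => hne (by rw [S.cell_disjoint hz hz'])
  · intro M hM
    obtain ⟨hne, o, rfl⟩ := (mem_cellFamily_iff S hv).1 hM
    refine ⟨fun t => ?_, S.cell_unordered hv, ?_⟩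
    · rw [Φ.image_eq_preimage_symm]
      exact Set.ext fun z => S.flow_mem_cell_iff hv t
    · have := S.isOpenCell_cell hv (MonotoneRepeller.nonempty_basin_of_nonempty_cell hne)
      rwa [finrank_euclideanSpace_fin] at this
  · intro μ _ hμ x hx
    rcases S.equilibria_stronglyOrdered_or_subset_cell hv (recurrentSet_support hμ)
      isPreconnected_connectedComponentIn (connectedComponentIn_subset μ.support x) with h | ⟨o, h⟩
    · rw [equilibria_reverse] at h
      exact Or.inl h
    · exact Or.inr ⟨_, (mem_cellFamily_iff S hv).2
        ⟨⟨x, h (mem_connectedComponentIn hx)⟩, o, rfl⟩, h⟩
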